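/- Fix an integer $m\ge 1$. For a complex-valued $q\in L^2(0,\pi)$ let $L_1(q)$ and $L_2(q)$ be the operators in $L^2(0,\pi)$ generated by $(-1)^m y^{(2m)}+q(x)y$ on $(0,\pi)$ with, respectively, the Dirichlet conditions $y^{(2i)}(0)=y^{(2i)}(\pi)=0$ $(0\le i\le m-1)$ and the Dirichlet–Neumann conditions $y^{(2i)}(0)=y^{(2i+1)}(\pi)=0$ $(0\le i\le m-1)$; the domain consists of those $y\in C^{2m-1}[0,\pi]$ with $y^{(2m-1)}$ absolutely continuous and $(-1)^m y^{(2m)}+qy\in L^2(0,\pi)$ that satisfy the boundary conditions. The eigenvalues of each of the two operators can be listed as a sequence $\{\lambda_n(q)\}_{n\ge1}$, respectively $\{\mu_n(q)\}_{n\ge1}$, repeated according to algebraic multiplicity and ordered by nondecreasing real part; fix any such listings. Let $M>0$. There are a positive integer $P_1$ and a constant $C>0$, depending only on $M$ (and on the fixed $m$), such that for every $q\in L^2(0,\pi)$ with $\|q\|_2<M$ and every $n>P_1$ the following holds. There are eigenfunctions $\phi_n(\cdot\,;q)$ of $L_1(q)$ for $\lambda_n(q)$ and $\psi_n(\cdot\,;q)$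 of $L_2(q)$ for $\mu_n(q)$ with the normalization $\int_0^\pi\phi_n^2\,dx=1$, $\int_0^\pi\psi_n^2\,dx=1$, and all eigenfunctions so normalized satisfy, after multiplication by a suitable sign $\pm1$, $$\sup_{x\in[0,\pi]}\Big|\phi_n(x;q)-\sqrt{\tfrac{2}{\pi}}\,\sin(nx)\Big|\le C\,\frac{\ln n}{n^{2m-1}},\qquad \sup_{x\in[0,\pi]}\Big|\psi_n(x;q)-\sqrt{\tfrac{2}{\pi}}\,\sin\big((n-\tfrac12)x\big)\Big|\le C\,\frac{\ln n}{n^{2m-1}}.$$ The same bounds hold, after multiplication by a suitable complex number of modulus $1$, for all eigenfunctions for $\lambda_n(q)$ and $\mu_n(q)$ normalized by $\int_0^\pi|\phi_n|^2\,dx=1$, $\int_0^\pi|\psi_n|^2\,dx=1$. -/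

import Mathlib

open Set MeasureTheory
open scoped Real

namespace HigherOrderSL

/-- The two families of boundary conditions on `[0, π]`. -/
inductive Boundary
  | dirichlet
  | dirichletNeumann

/-- The `k`-th derivative on the interval `[0, π]`, one-sided at the end points. It depends only on
the values of `y` on `[0, π]`. -/
noncomputable def D (k : ℕ) (y : ℝ → ℂ) : ℝ → ℂ := iteratedDerivWithin k y (Icc 0 π)

/-- Dirichlet: `y^(2i)(0) = y^(2i)(π) = 0` for `0 ≤ i ≤ m - 1`.
Dirichlet-Neumann: `y^(2i)(0) = y^(2i+1)(π) = 0` for `0 ≤ i ≤ m - 1`. -/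
def Boundary.Holds (m : ℕ) (y : ℝ → ℂ) : Boundary → Prop
  | .dirichlet => ∀ i < m, D (2 * i) y 0 = 0 ∧ D (2 * i) y π = 0
  | .dirichletNeumann => ∀ i < m, D (2 * i) y 0 = 0 ∧ D (2 * i + 1) y π = 0

/-- `n` for the Dirichlet problem, `n - 1/2` for the Dirichlet-Neumann problem. -/
noncomputable def Boundary.freq (n : ℕ) : Boundary → ℝ
  | .dirichlet => n
  | .dirichletNeumann => n - 1 / 2

/-- `y` lies in the domain of the operator generated by `(-1)^m y^(2m) + q y` and the boundary
conditions `b`, and is mapped to `g`: the functions `y, …, y^(2m-1)` exist and are continuous on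
`[0, π]`, `y^(2m-1)` is absolutely continuous there, the boundary conditions hold, and
`(-1)^m y^(2m) + q y = g` almost everywhere on `(0, π)`, where `y^(2m)` is the derivative of
`y^(2m-1)`. Below, `g` is always continuous on `[0, π]`, hence square integrable. -/
structure Maps (b : Boundary) (m : ℕ) (q y g : ℝ → ℂ) : Prop where
  contDiffOn : ContDiffOn ℝ ((2 * m - 1 : ℕ) : WithTop ℕ∞) y (Icc 0 π)
  absCont : AbsolutelyContinuousOnInterval (D (2 * m - 1) y) 0 π
  boundary : b.Holds m y
  equation : ∀ᵐ x ∂(volume.restrict (Ioo (0 : ℝ) π)), ∃ d : ℂ,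
    HasDerivWithinAt (D (2 * m - 1) y) d (Icc 0 π) x ∧ (-1) ^ m * d + q x * y x = g x

/-- `y` is an eigenfunction for the eigenvalue `z`, considered on `[0, π]` only. -/
def IsEigenfunction (b : Boundary) (m : ℕ) (q : ℝ → ℂ) (z : ℂ) (y : ℝ → ℂ) : Prop :=
  (∃ x ∈ Icc 0 π, y x ≠ 0) ∧ Maps b m q y (fun x => z * y x)

theorem D_add {k : ℕ} {y w : ℝ → ℂ} {n : ℕ}
    (hy : ContDiffOn ℝ (n : WithTop ℕ∞) y (Icc 0 π))
    (hw : ContDiffOn ℝ (n : WithTop ℕ∞) w (Icc 0 π)) (hk : k ≤ n) :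
    EqOn (D k (y + w)) (D k y + D k w) (Icc 0 π) := by
  intro x hx
  have h : ((k : ℕ) : WithTop ℕ∞) ≤ (n : WithTop ℕ∞) := by exact_mod_cast hk
  exact iteratedDerivWithin_add hx (uniqueDiffOn_Icc Real.pi_pos)
    ((hy.of_le h) x hx) ((hw.of_le h) x hx)

theorem D_smul (k : ℕ) (y : ℝ → ℂ) (c : ℂ) : D k (c • y) = c • D k y := by
  funext x
  exact iteratedDerivWithin_const_smul_field c y

theorem absCont_congr {f g : ℝ → ℂ} (h : EqOn f g (Icc 0 π))
    (hf : AbsolutelyContinuousOnInterval f 0 π) : AbsolutelyContinuousOnInterval g 0 π := by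
  rw [absolutelyContinuousOnInterval_iff] at hf ⊢
  intro ε hε
  obtain ⟨δ, hδ, H⟩ := hf ε hε
  refine ⟨δ, hδ, fun E hE hs => ?_⟩
  have := H E hE hs
  convert this using 1
  refine Finset.sum_congr rfl fun i hi => ?_
  have h2 := hE.1 i hi
  rw [uIcc_of_le Real.pi_pos.le] at h2
  rw [h h2.1, h h2.2]

theorem Maps.add {b : Boundary} {m : ℕ} {q y w g h : ℝ → ℂ} (hm : 1 ≤ m)
    (hy : Maps b m q y g) (hw : Maps b m q w h) : Maps b m q (y + w) (g + h) where
  contDiffOn := hy.contDiffOn.add hw.contDiffOn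
  absCont := absCont_congr (D_add hy.contDiffOn hw.contDiffOn le_rfl).symm
    (hy.absCont.add hw.absCont)
  boundary := by
    have h0 : (0 : ℝ) ∈ Icc 0 π := ⟨le_rfl, Real.pi_pos.le⟩
    have hπ : π ∈ Icc 0 π := ⟨Real.pi_pos.le, le_rfl⟩
    have A := hy.boundary
    have B := hw.boundary
    cases b <;>
    · intro i hi
      obtain ⟨a1, a2⟩ := A i hi
      obtain ⟨b1, b2⟩ := B i hi
      constructor
      · rw [D_add hy.contDiffOn hw.contDiffOn (by omega) h0]
        simp [a1, b1]
      · rw [D_add hy.contDiffOn hw.contDiffOn (by omega) hπ]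
        simp [a2, b2]
  equation := by
    filter_upwards [hy.equation, hw.equation, ae_restrict_mem measurableSet_Ioo]
      with x ⟨d, hd, ed⟩ ⟨e, he, ee⟩ hx
    have E := D_add hy.contDiffOn hw.contDiffOn (le_refl (2 * m - 1))
    refine ⟨d + e, (hd.add he).congr E (E (Ioo_subset_Icc_self hx)), ?_⟩
    simp only [Pi.add_apply, ← ed, ← ee]
    ring

theorem Maps.smul {b : Boundary} {m : ℕ} {q y g : ℝ → ℂ} (c : ℂ)
    (hy : Maps b m q y g) : Maps b m q (c • y) (c • g) where
  contDiffOn := hy.contDiffOn.const_smul c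
  absCont := by
    rw [D_smul]
    exact hy.absCont.const_smul c
  boundary := by
    have A := hy.boundary
    cases b <;>
    · intro i hi
      obtain ⟨a1, a2⟩ := A i hi
      simp [D_smul, a1, a2]
  equation := by
    filter_upwards [hy.equation] with x ⟨d, hd, ed⟩
    refine ⟨c * d, ?_, ?_⟩
    · rw [D_smul]
      exact hd.const_smul c
    · simp only [Pi.smul_apply, smul_eq_mul, ← ed]
      ring

theorem maps_zero (b : Boundary) (m : ℕ) (q : ℝ → ℂ) : Maps b m q 0 0 := by
  have hD : ∀ k, D k (0 : ℝ → ℂ) = 0 := fun k => by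
    simpa using D_smul k (0 : ℝ → ℂ) 0
  refine ⟨contDiffOn_const, ?_, ?_, ?_⟩
  · rw [hD, absolutelyContinuousOnInterval_iff]
    intro ε hε
    exact ⟨1, one_pos, fun E _ _ => by simpa using hε⟩
  · cases b <;> intro i _ <;> simp [hD]
  · refine Filter.Eventually.of_forall fun x => ⟨0, ?_, by simp⟩
    rw [hD]
    exact hasDerivWithinAt_const x _ (0 : ℂ)

/-- The preimage of the space `W` under `L - z`, where `L` is the operator of the problem.
Functions on `[0, π]` are represented by their extensions by zero. -/
def preimage (b : Boundary) (m : ℕ) (hm : 1 ≤ m) (q : ℝ → ℂ) (z : ℂ)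
    (W : Submodule ℂ (ℝ → ℂ)) : Submodule ℂ (ℝ → ℂ) where
  carrier := {y | (∀ x, x ∉ Icc 0 π → y x = 0) ∧ ∃ w ∈ W, Maps b m q y (z • y + w)}
  zero_mem' := ⟨fun _ _ => rfl, 0, W.zero_mem, by simpa using maps_zero b m q⟩
  add_mem' := by
    rintro y y' ⟨hs, w, hw, h⟩ ⟨hs', w', hw', h'⟩
    refine ⟨fun x hx => by simp [hs x hx, hs' x hx], w + w', W.add_mem hw hw', ?_⟩
    have := h.add hm h'
    rwa [show z • y + w + (z • y' + w') = z • (y + y') + (w + w') by rw [smul_add]; abel] at this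
  smul_mem' := by
    rintro c y ⟨hs, w, hw, h⟩
    refine ⟨fun x hx => by simp [hs x hx], c • w, W.smul_mem c hw, ?_⟩
    have := h.smul c
    rwa [smul_add, smul_comm c z y] at this

/-- `ker (L - z)^k`. -/
def rootSpace (b : Boundary) (m : ℕ) (hm : 1 ≤ m) (q : ℝ → ℂ) (z : ℂ) :
    ℕ → Submodule ℂ (ℝ → ℂ)
  | 0 => ⊥
  | k + 1 => preimage b m hm q z (rootSpace b m hm q z k)

/-- The algebraic multiplicity of `z`: the dimension of the union of the increasing sequence
`ker (L - z)^k`. It is `0` if `z` is not an eigenvalue. -/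
noncomputable def algMult (b : Boundary) (m : ℕ) (hm : 1 ≤ m) (q : ℝ → ℂ) (z : ℂ) : ℕ∞ :=
  Cardinal.toENat (Module.rank ℂ ↥(⨆ k : ℕ, rootSpace b m hm q z k))

/-- `Λ 1, Λ 2, …` lists the eigenvalues, each repeated according to its algebraic multiplicity, by
nondecreasing real parts (increasing order, if they are real). The value `Λ 0` plays no role. -/
def IsEigenvalueSequence (b : Boundary) (m : ℕ) (hm : 1 ≤ m) (q : ℝ → ℂ) (Λ : ℕ → ℂ) : Prop :=
  (∀ z : ℂ, {n : ℕ | 1 ≤ n ∧ Λ n = z}.encard = algMult b m hm q z) ∧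
  ∀ i j : ℕ, 1 ≤ i → i ≤ j → (Λ i).re ≤ (Λ j).re

end HigherOrderSL

/-! In the orthonormal basis of modes `√(2/π) sin(freq x)` the operator becomes a diagonal matrix
with entries `d k = freq ^ (2 * m)` plus the matrix `Q` of the potential. All that is known of `Q`,
and all that is needed, is that its entries are bounded by `A = (2/π) M √π`. So `Q` maps absolutely
summable sequences to bounded ones, and dividing by `d k - z` leads back to summable ones at the
cost of `∑ 1/|d k - z|`. If `z` lies in the annulus around `d n` bounded by the midpoints to its
neighbours, this sum without the term `k = n` is at most twice `∑ 1/|d k - d n|`, which is `O(ln n /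
n^(2m-1))` by `gap_sum_le`.

Eigenfunctions: for an eigenvalue in that annulus, the coefficients other than the `n`-th have total
size at most a constant times this sum times the `n`-th one (`concentration`). Summing the series
uniformly gives the sup-norm estimate up to a scalar (`IsEigenfunction.approx`), and either
normalization fixes the scalar up to a sign or a phase (`exists_sign`, `exists_phase`).

Position of the eigenvalues: it must be shown that the `n`-th entry of every listing does lie in the
`n`-th annulus, with algebraic multiplicities counted for a non-self-adjoint operator. The number of
eigenvalues in a disc of midpoint radius is found by block diagonalization. The span of the first
`N` modes is deformed into an invariant graph `{(v, K v)}`, where `K` solves a Riccati equation by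
contraction (`exists_riccati_fixedPoint`). On this graph the operator is an `N × N` matrix with all
its eigenvalues in the disc, and every root function for a point of the disc lies in the graph
(`exists_invariant_subspace`). Hence the multiplicities are those of the roots of a characteristic
polynomial of degree `N` (`exists_multiset_algMult`).

The listing is ordered by real part, whereas the discs concern the modulus. The two orders agree
because an eigenvalue outside a large disc has real part at least the radius (`gapRadius_le_re`);
`IsListing.annulus` then locates the entries.

The passage between functions and coefficients rests on Green's formula, on completeness of the
modes (`eqOn_of_coef_eq`) and on solvability for zero potential (`exists_maps_zero_potential`). -/

namespace HigherOrderSL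

/-! ### Riccati equation for the invariant graph -/

section Riccati

/-- The matrix `Q (1 + K)`, where `K` has the entries `w l j * F l j`. -/
noncomputable def coupling (Q : ℕ → ℕ → ℂ) (w : ℕ → ℕ → ℝ) (F : ℕ → ℕ → ℂ) (i j : ℕ) : ℂ :=
  Q i j + ∑' l, Q i l * (w l j * F l j)

variable {Q : ℕ → ℕ → ℂ} {w : ℕ → ℕ → ℝ} {A τ : ℝ}

theorem summable_coupling_term (hQ : ∀ i j, ‖Q i j‖ ≤ A) (hw : ∀ i j, 0 ≤ w i j)
    (hs : ∀ j, Summable fun l => w l j) {F : ℕ → ℕ → ℂ} {B : ℝ} (hF : ∀ i j, ‖F i j‖ ≤ B)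
    (i j : ℕ) : Summable fun l => ‖Q i l * (w l j * F l j)‖ := by
  have hA : 0 ≤ A := (norm_nonneg _).trans (hQ 0 0)
  refine Summable.of_nonneg_of_le (fun _ => norm_nonneg _) (fun l => ?_) ((hs j).mul_left (A * B))
  rw [norm_mul, norm_mul, Complex.norm_real, Real.norm_of_nonneg (hw l j)]
  calc _ ≤ A * (w l j * B) := by gcongr; exacts [mul_nonneg (hw l j) (norm_nonneg _), hQ i l, hw l j, hF l j]
    _ = _ := by ring

theorem norm_tsum_coupling_le (hQ : ∀ i j, ‖Q i j‖ ≤ A) (hw : ∀ i j, 0 ≤ w i j)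
    (hs : ∀ j, Summable fun l => w l j) (hτ : ∀ j, ∑' l, w l j ≤ τ)
    {F : ℕ → ℕ → ℂ} {B : ℝ} (hF : ∀ i j, ‖F i j‖ ≤ B) (i j : ℕ) :
    ‖∑' l, Q i l * (w l j * F l j)‖ ≤ A * B * τ := by
  have hA : 0 ≤ A := (norm_nonneg _).trans (hQ 0 0)
  have hB : 0 ≤ B := (norm_nonneg _).trans (hF 0 0)
  have h1 := summable_coupling_term hQ hw hs hF i j
  calc _ ≤ ∑' l, ‖Q i l * (w l j * F l j)‖ := norm_tsum_le_tsum_norm h1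
    _ ≤ ∑' l, A * B * w l j := by
      refine h1.tsum_le_tsum (fun l => ?_) ((hs j).mul_left _)
      rw [norm_mul, norm_mul, Complex.norm_real, Real.norm_of_nonneg (hw l j)]
      calc _ ≤ A * (w l j * B) := by gcongr; exacts [mul_nonneg (hw l j) (norm_nonneg _), hQ i l, hw l j, hF l j]
        _ = _ := by ring
    _ = A * B * ∑' l, w l j := tsum_mul_left
    _ ≤ _ := by gcongr; exact hτ j

theorem norm_coupling_le (hQ : ∀ i j, ‖Q i j‖ ≤ A) (hw : ∀ i j, 0 ≤ w i j)
    (hs : ∀ j, Summable fun l => w l j) (hτ : ∀ j, ∑' l, w l j ≤ τ)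
    {F : ℕ → ℕ → ℂ} {B : ℝ} (hF : ∀ i j, ‖F i j‖ ≤ B) (i j : ℕ) :
    ‖coupling Q w F i j‖ ≤ A + A * B * τ :=
  (norm_add_le _ _).trans (add_le_add (hQ i j) (norm_tsum_coupling_le hQ hw hs hτ hF i j))

theorem norm_coupling_sub_le (hQ : ∀ i j, ‖Q i j‖ ≤ A) (hw : ∀ i j, 0 ≤ w i j)
    (hs : ∀ j, Summable fun l => w l j) (hτ : ∀ j, ∑' l, w l j ≤ τ)
    {F G : ℕ → ℕ → ℂ} {B δ : ℝ} (hF : ∀ i j, ‖F i j‖ ≤ B) (hG : ∀ i j, ‖G i j‖ ≤ B)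
    (hFG : ∀ i j, ‖F i j - G i j‖ ≤ δ) (i j : ℕ) :
    ‖coupling Q w F i j - coupling Q w G i j‖ ≤ A * δ * τ := by
  have h := norm_tsum_coupling_le (F := F - G) hQ hw hs hτ hFG i j
  have e : coupling Q w F i j - coupling Q w G i j
      = ∑' l, Q i l * (w l j * (F - G) l j) := by
    unfold coupling
    rw [add_sub_add_left_eq_sub, ← Summable.tsum_sub
      (summable_coupling_term hQ hw hs hF i j).of_norm
      (summable_coupling_term hQ hw hs hG i j).of_norm]
    refine tsum_congr fun l => ?_
    simp only [Pi.sub_apply]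
    ring
  rwa [e]

/-- The right-hand side of the Riccati equation. -/
noncomputable def riccati (N : ℕ) (Q : ℕ → ℕ → ℂ) (w : ℕ → ℕ → ℝ) (F : ℕ → ℕ → ℂ)
    (k j : ℕ) : ℂ :=
  -coupling Q w F k j + ∑ i : Fin N, w k i * F k i * coupling Q w F i j

theorem norm_riccati_le {N : ℕ} (hQ : ∀ i j, ‖Q i j‖ ≤ A) (hw : ∀ i j, 0 ≤ w i j)
    (hs : ∀ j, Summable fun l => w l j) (hτ : ∀ j, ∑' l, w l j ≤ τ)
    (hr : ∀ k, ∑ i : Fin N, w k i ≤ τ)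
    {F : ℕ → ℕ → ℂ} {B : ℝ} (hF : ∀ i j, ‖F i j‖ ≤ B) (k j : ℕ) :
    ‖riccati N Q w F k j‖ ≤ (A + A * B * τ) + τ * (B * (A + A * B * τ)) := by
  have hB : 0 ≤ B := (norm_nonneg _).trans (hF 0 0)
  have hS := norm_coupling_le hQ hw hs hτ hF
  have hS0 : 0 ≤ A + A * B * τ := (norm_nonneg _).trans (hS 0 0)
  refine (norm_add_le _ _).trans (add_le_add (by rw [norm_neg]; exact hS k j) ?_)
  calc _ ≤ ∑ i : Fin N, w k i * (B * (A + A * B * τ)) := by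
        refine norm_sum_le_of_le _ fun i _ => ?_
        rw [norm_mul, norm_mul, Complex.norm_real, Real.norm_of_nonneg (hw k i), mul_assoc]
        gcongr
        exacts [hw k i, hF k i, hS i j]
    _ ≤ _ := by
        rw [← Finset.sum_mul]
        gcongr
        exact hr k

theorem norm_riccati_sub_le {N : ℕ} (hQ : ∀ i j, ‖Q i j‖ ≤ A) (hw : ∀ i j, 0 ≤ w i j)
    (hs : ∀ j, Summable fun l => w l j) (hτ : ∀ j, ∑' l, w l j ≤ τ)
    (hr : ∀ k, ∑ i : Fin N, w k i ≤ τ)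
    {F G : ℕ → ℕ → ℂ} {B δ : ℝ} (hF : ∀ i j, ‖F i j‖ ≤ B) (hG : ∀ i j, ‖G i j‖ ≤ B)
    (hFG : ∀ i j, ‖F i j - G i j‖ ≤ δ) (k j : ℕ) :
    ‖riccati N Q w F k j - riccati N Q w G k j‖
      ≤ A * δ * τ + τ * (δ * (A + A * B * τ) + B * (A * δ * τ)) := by
  have hB : 0 ≤ B := (norm_nonneg _).trans (hF 0 0)
  have hδ : 0 ≤ δ := (norm_nonneg _).trans (hFG 0 0)
  have hS := norm_coupling_le hQ hw hs hτ hF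
  have hD := norm_coupling_sub_le hQ hw hs hτ hF hG hFG
  have hS0 : 0 ≤ A + A * B * τ := (norm_nonneg _).trans (hS 0 0)
  have hD0 : 0 ≤ A * δ * τ := (norm_nonneg _).trans (hD 0 0)
  have e : riccati N Q w F k j - riccati N Q w G k j
      = -(coupling Q w F k j - coupling Q w G k j)
        + ∑ i : Fin N, w k i * ((F k i - G k i) * coupling Q w F i j
          + G k i * (coupling Q w F i j - coupling Q w G i j)) := by
    have : ∑ i : Fin N, (w k i : ℂ) * ((F k i - G k i) * coupling Q w F i j
          + G k i * (coupling Q w F i j - coupling Q w G i j))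
        = ∑ i : Fin N, w k i * F k i * coupling Q w F i j
          - ∑ i : Fin N, w k i * G k i * coupling Q w G i j := by
      rw [← Finset.sum_sub_distrib]
      exact Finset.sum_congr rfl fun i _ => by ring
    rw [this]
    unfold riccati
    ring
  rw [e]
  refine (norm_add_le _ _).trans (add_le_add (by rw [norm_neg]; exact hD k j) ?_)
  calc _ ≤ ∑ i : Fin N, w k i * (δ * (A + A * B * τ) + B * (A * δ * τ)) := by
        refine norm_sum_le_of_le _ fun i _ => ?_
        rw [norm_mul, Complex.norm_real, Real.norm_of_nonneg (hw k i)]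
        refine mul_le_mul_of_nonneg_left ((norm_add_le _ _).trans ?_) (hw k i)
        rw [norm_mul, norm_mul]
        gcongr
        exacts [hFG k i, hS i j, hG k i, hD i j]
    _ ≤ _ := by
        rw [← Finset.sum_mul]
        gcongr
        exact hr k

/-- Writing `K k j = F k j / (d k - d j)`, invariance of the graph of `K` reads `F = riccati F`. The
unknown `F` is only bounded, while the weights `w` carry all the decay, so the equation is solved in
the bounded functions on `ℕ × ℕ`. With `t = A τ ≤ 1/8` the ball of radius `2 A` is preserved because
`(1 + 2 t)² ≤ 2`, and the Lipschitz constant there is `2 t + 4 t² ≤ 1/2`. -/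
theorem exists_riccati_fixedPoint {N : ℕ} (hQ : ∀ i j, ‖Q i j‖ ≤ A) (hw : ∀ i j, 0 ≤ w i j)
    (hs : ∀ j, Summable fun l => w l j) (hτ : ∀ j, ∑' l, w l j ≤ τ)
    (hr : ∀ k, ∑ i : Fin N, w k i ≤ τ) (hAτ : A * τ ≤ 1 / 8) :
    ∃ F : ℕ → ℕ → ℂ, (∀ k j, ‖F k j‖ ≤ 2 * A) ∧ ∀ k j, F k j = riccati N Q w F k j := by
  have hA : 0 ≤ A := (norm_nonneg _).trans (hQ 0 0)
  have hτ0 : 0 ≤ τ := (tsum_nonneg fun l => hw l 0).trans (hτ 0)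
  have hAτ0 : 0 ≤ A * τ := mul_nonneg hA hτ0
  let X := BoundedContinuousFunction (ℕ × ℕ) ℂ
  let Φ : X → X := fun F => BoundedContinuousFunction.ofNormedAddCommGroupDiscrete
    (fun p => riccati N Q w (fun k j => F (k, j)) p.1 p.2) _
    (fun p => norm_riccati_le hQ hw hs hτ hr (fun k j => F.norm_coe_le_norm (k, j)) p.1 p.2)
  have hΦ : ∀ (F : X) p, Φ F p = riccati N Q w (fun k j => F (k, j)) p.1 p.2 := fun _ _ => rfl
  let s : Set X := Metric.closedBall 0 (2 * A)
  have hmem : ∀ F : X, F ∈ s → ∀ k j, ‖F (k, j)‖ ≤ 2 * A := fun F hF k j =>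
    (F.norm_coe_le_norm _).trans (by simpa [s] using hF)
  have hmaps : MapsTo Φ s s := by
    intro F hF
    have : ‖Φ F‖ ≤ 2 * A := by
      refine (BoundedContinuousFunction.norm_le (by positivity)).2 fun p => ?_
      rw [hΦ]
      refine (norm_riccati_le hQ hw hs hτ hr (hmem F hF) p.1 p.2).trans ?_
      nlinarith [mul_nonneg hAτ0 hA, mul_nonneg hA (mul_nonneg hAτ0 (sub_nonneg.2 hAτ)),
        mul_nonneg hA (sub_nonneg.2 hAτ)]
    simpa [s] using this
  have hc : ContractingWith (1 / 2 : NNReal) (hmaps.restrict Φ s s) := by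
    refine ⟨by rw [← NNReal.coe_lt_coe]; norm_num, LipschitzWith.of_dist_le_mul fun F G => ?_⟩
    have hd : ∀ k j, ‖(F : X) (k, j) - (G : X) (k, j)‖ ≤ dist F G := fun k j => by
      rw [← dist_eq_norm]
      exact BoundedContinuousFunction.dist_coe_le_dist _
    refine (BoundedContinuousFunction.dist_le (by positivity)).2 fun p => ?_
    rw [dist_eq_norm]
    refine (norm_riccati_sub_le hQ hw hs hτ hr (hmem F F.2) (hmem G G.2) hd p.1 p.2).trans ?_
    have h0 : 0 ≤ dist F G := dist_nonneg
    have e : A * dist F G * τ + τ * (dist F G * (A + A * (2 * A) * τ)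
        + 2 * A * (A * dist F G * τ)) = dist F G * (2 * (A * τ) + 4 * (A * τ) ^ 2) := by ring
    rw [e, mul_comm]
    have : 2 * (A * τ) + 4 * (A * τ) ^ 2 ≤ ((1 / 2 : NNReal) : ℝ) := by
      have : ((1 / 2 : NNReal) : ℝ) = 1 / 2 := by norm_num
      rw [this]
      nlinarith
    gcongr
  obtain ⟨F, hF, hfix, -⟩ := hc.exists_fixedPoint' (x := 0)
    (Metric.isClosed_closedBall.isComplete) hmaps (by simp [s, hA]) (edist_ne_top _ _)
  refine ⟨fun k j => F (k, j), hmem F hF, fun k j => ?_⟩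
  rw [← hΦ F (k, j), hfix]

end Riccati

/-! ### Distance from a spectral parameter to the diagonal entries -/

section Separation

variable {d : ℕ → ℝ} {n : ℕ} {z : ℂ}

/-- For `k ≤ n` the midpoint radius exceeds `d k` by at least half of `d (n + 1) - d k`, as `d k ≤ d
n`; the reverse triangle inequality carries this over to complex `z`. The next lemma is the mirror
image for `k > n`. -/
theorem norm_sub_inv_le_of_le (hd : StrictMono d) (hd0 : ∀ k, 0 ≤ d k)
    (hz : (d n + d (n + 1)) / 2 ≤ ‖z‖) {k : ℕ} (hk : k ≤ n) :
    0 < ‖(d k : ℂ) - z‖ ∧ ‖(d k : ℂ) - z‖⁻¹ ≤ 2 * |d k - d (n + 1)|⁻¹ := by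
  have h1 : d k ≤ d n := hd.monotone hk
  have h2 : d n < d (n + 1) := hd n.lt_succ_self
  have h3 : ‖z‖ - d k ≤ ‖(d k : ℂ) - z‖ := by
    have := norm_sub_norm_le z (d k : ℂ)
    rwa [Complex.norm_real, Real.norm_of_nonneg (hd0 k), norm_sub_rev] at this
  have h4 : |d k - d (n + 1)| = d (n + 1) - d k := by rw [abs_sub_comm, abs_of_pos]; linarith
  have h5 : (d (n + 1) - d k) / 2 ≤ ‖(d k : ℂ) - z‖ := by linarith
  refine ⟨by linarith, ?_⟩
  rw [h4]
  calc _ ≤ ((d (n + 1) - d k) / 2)⁻¹ := inv_anti₀ (by linarith) h5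
    _ = _ := by rw [inv_div]; ring

theorem norm_sub_inv_le_of_lt (hd : StrictMono d) (hd0 : ∀ k, 0 ≤ d k)
    (hz : ‖z‖ ≤ (d n + d (n + 1)) / 2) {k : ℕ} (hk : n < k) :
    0 < ‖(d k : ℂ) - z‖ ∧ ‖(d k : ℂ) - z‖⁻¹ ≤ 2 * |d k - d n|⁻¹ := by
  have h1 : d (n + 1) ≤ d k := hd.monotone hk
  have h2 : d n < d (n + 1) := hd n.lt_succ_self
  have h3 : d k - ‖z‖ ≤ ‖(d k : ℂ) - z‖ := by
    have := norm_sub_norm_le (d k : ℂ) z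
    rwa [Complex.norm_real, Real.norm_of_nonneg (hd0 k)] at this
  have h4 : |d k - d n| = d k - d n := by rw [abs_of_pos]; linarith
  have h5 : (d k - d n) / 2 ≤ ‖(d k : ℂ) - z‖ := by linarith
  refine ⟨by linarith, ?_⟩
  rw [h4]
  calc _ ≤ ((d k - d n) / 2)⁻¹ := inv_anti₀ (by linarith) h5
    _ = _ := by rw [inv_div]; ring

end Separation

/-! ### Invariant subspace of the infinite matrix and concentration of eigenvectors -/

section InvariantSubspace

/-- The reciprocals of the differences between `d k`, `k > n`, and `d j`, `j ≤ n`. -/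
noncomputable def gapWeight (d : ℕ → ℝ) (n k j : ℕ) : ℝ :=
  if j ≤ n ∧ n < k then (d k - d j)⁻¹ else 0

variable {d : ℕ → ℝ} {n : ℕ} {τ : ℝ}

theorem gapWeight_nonneg (hd : StrictMono d) (k j : ℕ) : 0 ≤ gapWeight d n k j := by
  unfold gapWeight
  split_ifs with h
  · exact inv_nonneg.2 (sub_nonneg.2 (hd.monotone (h.1.trans h.2.le)))
  · exact le_rfl

/-- This majorant does not depend on `j` and controls the column sums of the weights; that of
`gapWeight_le_right` does not depend on `k` and controls the row sums. This is why the gap sums at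
both `n` and `n + 1` must be small. -/
theorem gapWeight_le_left (hd : StrictMono d) (k j : ℕ) :
    gapWeight d n k j ≤ |d k - d n|⁻¹ := by
  unfold gapWeight
  split_ifs with h
  · have h1 : d j ≤ d n := hd.monotone h.1
    have h2 : d n < d k := hd h.2
    rw [abs_of_pos (by linarith)]
    exact inv_anti₀ (by linarith) (by linarith)
  · positivity

theorem gapWeight_le_right (hd : StrictMono d) (k j : ℕ) :
    gapWeight d n k j ≤ |d j - d (n + 1)|⁻¹ := by
  unfold gapWeight
  split_ifs with h
  · have h1 : d (n + 1) ≤ d k := hd.monotone h.2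
    have h2 : d j < d (n + 1) := hd (Nat.lt_succ_of_le h.1)
    rw [abs_sub_comm, abs_of_pos (by linarith)]
    exact inv_anti₀ (by linarith) (by linarith)
  · positivity

theorem sum_fin_le_tsum {f : ℕ → ℝ} (hf : Summable f) (h0 : ∀ k, 0 ≤ f k) (N : ℕ) :
    ∑ i : Fin N, f i ≤ ∑' k, f k := by
  rw [Fin.sum_univ_eq_sum_range]
  exact hf.sum_le_tsum _ fun i _ => h0 i

/-- Extension by zero of a vector with `N` entries. -/
def extendZero {N : ℕ} (v : Fin N → ℂ) (k : ℕ) : ℂ := if h : k < N then v ⟨k, h⟩ else 0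

@[simp] theorem extendZero_fin {N : ℕ} (v : Fin N → ℂ) (i : Fin N) : extendZero v i = v i := by
  simp [extendZero]

theorem hasSum_extendZero {N : ℕ} (v : Fin N → ℂ) (c : ℕ → ℂ) :
    HasSum (fun k => c k * extendZero v k) (∑ j : Fin N, c j * v j) := by
  have h : HasSum (fun k => c k * extendZero v k)
      (∑ k ∈ Finset.range N, c k * extendZero v k) :=
    hasSum_sum_of_ne_finset_zero fun k hk => by
      have : ¬ k < N := by simpa using hk
      simp [extendZero, this]
  rw [← Fin.sum_univ_eq_sum_range (fun k => c k * extendZero v k)] at h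
  simpa using h

/-- The map `v ↦ (v, K v)`, where `K` has the entries `w k j * F k j`. -/
noncomputable def graphMap (N : ℕ) (w : ℕ → ℕ → ℝ) (F : ℕ → ℕ → ℂ) :
    (Fin N → ℂ) →ₗ[ℂ] (ℕ → ℂ) where
  toFun v k := extendZero v k + ∑ j : Fin N, w k j * F k j * v j
  map_add' v v' := by
    funext k
    simp only [Pi.add_apply, mul_add, Finset.sum_add_distrib, extendZero]
    split_ifs <;> ring
  map_smul' c v := by
    funext k
    simp only [Pi.smul_apply, smul_eq_mul, RingHom.id_apply, mul_add, Finset.mul_sum, extendZero]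
    congr 1
    · split_ifs <;> simp
    · exact Finset.sum_congr rfl fun _ _ => by ring

/-- The restriction of the operator to the graph, in the coordinates `v`. -/
noncomputable def blockMap (N : ℕ) (d : ℕ → ℝ) (S : ℕ → ℕ → ℂ) : Module.End ℂ (Fin N → ℂ) where
  toFun v i := d i * v i + ∑ j : Fin N, S i j * v j
  map_add' v v' := by
    funext i
    simp only [Pi.add_apply, mul_add, Finset.sum_add_distrib]
    ring
  map_smul' c v := by
    funext i
    simp only [Pi.smul_apply, smul_eq_mul, RingHom.id_apply, mul_add, Finset.mul_sum]
    congr 1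
    · ring
    · exact Finset.sum_congr rfl fun _ _ => by ring

theorem hasSum_mul_graphMap {N : ℕ} {Q : ℕ → ℕ → ℂ} {w : ℕ → ℕ → ℝ} {A B : ℝ}
    (hQ : ∀ i j, ‖Q i j‖ ≤ A) (hw : ∀ i j, 0 ≤ w i j)
    (hs : ∀ j, Summable fun l => w l j) {F : ℕ → ℕ → ℂ} (hF : ∀ i j, ‖F i j‖ ≤ B)
    (v : Fin N → ℂ) (i : ℕ) :
    HasSum (fun k => Q i k * graphMap N w F v k) (∑ j : Fin N, coupling Q w F i j * v j) := by
  have h2 : HasSum (fun k => ∑ j : Fin N, Q i k * (w k j * F k j) * v j)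
      (∑ j : Fin N, (∑' k, Q i k * (w k j * F k j)) * v j) :=
    hasSum_sum fun j _ => (summable_coupling_term hQ hw hs hF i j).of_norm.hasSum.mul_right _
  have h3 := (hasSum_extendZero v (Q i)).add h2
  rw [← Finset.sum_add_distrib] at h3
  simp_rw [← add_mul] at h3
  suffices e : (fun k => Q i k * graphMap N w F v k) = fun k => Q i k * extendZero v k
      + ∑ j : Fin N, Q i k * (w k j * F k j) * v j by
    rw [e]
    exact h3
  funext k
  change Q i k * (extendZero v k + ∑ j : Fin N, w k j * F k j * v j) = _
  rw [mul_add, Finset.mul_sum]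
  congr 1
  exact Finset.sum_congr rfl fun _ _ => by ring

theorem summable_graphMap {N : ℕ} {w : ℕ → ℕ → ℝ} {B : ℝ} (hw : ∀ i j, 0 ≤ w i j)
    (hs : ∀ j, Summable fun l => w l j) {F : ℕ → ℕ → ℂ} (hF : ∀ i j, ‖F i j‖ ≤ B)
    (v : Fin N → ℂ) : Summable fun k => ‖graphMap N w F v k‖ := by
  have h1 : Summable fun k => ‖extendZero v k‖ := summable_of_ne_finset_zero (s := Finset.range N)
    fun k hk => by
      have : ¬ k < N := by simpa using hk
      simp [extendZero, this]
  have h2 : Summable fun k => ∑ j : Fin N, w k j * (B * ‖v j‖) :=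
    summable_sum fun j _ => (hs j).mul_right _
  refine Summable.of_nonneg_of_le (fun _ => norm_nonneg _) (fun k => ?_) (h1.add h2)
  refine (norm_add_le _ _).trans (add_le_add le_rfl (norm_sum_le_of_le _ fun j _ => ?_))
  rw [norm_mul, norm_mul, Complex.norm_real, Real.norm_of_nonneg (hw k j), mul_assoc]
  gcongr
  exacts [hw k j, hF k j]

/-- `E` parametrizes the invariant graph by its first `n + 1` coordinates and `B` is the matrix
induced there. The last two clauses make the splitting spectral: preimages of the graph under the
matrix minus `z` stay in the graph for `z` in the closed disc, and `B` has no eigenvalue on or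
outside its boundary. Both follow by inverting the diagonal part, which turns the equation into a
bound of an `ℓ¹` norm by half of itself. -/
theorem exists_invariant_subspace (hd : StrictMono d) (hd0 : ∀ k, 0 ≤ d k)
    {Q : ℕ → ℕ → ℂ} {A : ℝ} (hQ : ∀ i j, ‖Q i j‖ ≤ A)
    (h1 : Summable fun k => |d k - d n|⁻¹) (h1τ : ∑' k, |d k - d n|⁻¹ ≤ τ)
    (h2 : Summable fun k => |d k - d (n + 1)|⁻¹) (h2τ : ∑' k, |d k - d (n + 1)|⁻¹ ≤ τ)
    (hAτ : A * τ ≤ 1 / 8) :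
    ∃ (E : (Fin (n + 1) → ℂ) →ₗ[ℂ] (ℕ → ℂ)) (B : Module.End ℂ (Fin (n + 1) → ℂ)),
      Function.Injective E ∧
      (∀ v, Summable fun k => ‖E v k‖) ∧
      (∀ v j, d j * E v j + ∑' k, Q j k * E v k = E (B v) j) ∧
      (∀ (u : ℕ → ℂ) (z : ℂ) a, (Summable fun k => ‖u k‖) → ‖z‖ ≤ (d n + d (n + 1)) / 2 →
        (∀ j, d j * u j + ∑' k, Q j k * u k = z * u j + E a j) → ∃ v, u = E v) ∧
      (∀ (z : ℂ) v, (d n + d (n + 1)) / 2 ≤ ‖z‖ → B v = z • v → v = 0) := by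
  have hA : 0 ≤ A := (norm_nonneg _).trans (hQ 0 0)
  have hτ0 : 0 ≤ τ := (tsum_nonneg fun l => by positivity).trans h1τ
  have hAτ0 : 0 ≤ A * τ := mul_nonneg hA hτ0
  set w := gapWeight d n with hw_def
  have hw : ∀ i j, 0 ≤ w i j := gapWeight_nonneg hd
  have hs : ∀ j, Summable fun l => w l j := fun j =>
    Summable.of_nonneg_of_le (fun l => hw l j) (fun l => gapWeight_le_left hd l j) h1
  have hc : ∀ j, ∑' l, w l j ≤ τ := fun j =>
    ((hs j).tsum_le_tsum (fun l => gapWeight_le_left hd l j) h1).trans h1τ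
  have hr : ∀ k, ∑ i : Fin (n + 1), w k i ≤ τ := fun k =>
    (Finset.sum_le_sum fun (i : Fin (n + 1)) _ => gapWeight_le_right hd k (i : ℕ)).trans
      ((sum_fin_le_tsum h2 (fun _ => by positivity) _).trans h2τ)
  obtain ⟨F, hF, hfix⟩ := exists_riccati_fixedPoint (N := n + 1) hQ hw hs hc hr hAτ
  set S := coupling Q w F with hS_def
  have hS : ∀ i j, ‖S i j‖ ≤ 2 * A := fun i j =>
    (norm_coupling_le hQ hw hs hc hF i j).trans (by nlinarith)
  set E := graphMap (n + 1) w F with hE_def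
  set B := blockMap (n + 1) d S with hB_def
  have hElow : ∀ v (i : Fin (n + 1)), E v i = v i := by
    intro v i
    have : ∀ j, w i j = 0 := fun j => if_neg (by have := i.2; omega)
    change extendZero v i + ∑ j : Fin (n + 1), w i j * F i j * v j = v i
    simp [this]
  have hEhigh : ∀ v k, n < k → E v k = ∑ j : Fin (n + 1), w k j * F k j * v j := by
    intro v k hk
    change extendZero v k + _ = _
    rw [extendZero, dif_neg (by omega), zero_add]
  have hEs : ∀ v, Summable fun k => ‖E v k‖ := summable_graphMap hw hs hF
  have hsum : ∀ v i, HasSum (fun k => Q i k * E v k) (∑ j : Fin (n + 1), S i j * v j) :=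
    hasSum_mul_graphMap hQ hw hs hF
  have hinv : ∀ v j, d j * E v j + ∑' k, Q j k * E v k = E (B v) j := by
    intro v k
    rw [(hsum v k).tsum_eq]
    rcases le_or_gt k n with hk | hk
    · have e1 := hElow v ⟨k, by omega⟩
      have e2 := hElow (B v) ⟨k, by omega⟩
      simp only at e1 e2
      rw [e1, e2]
      rfl
    · rw [hEhigh v k hk, hEhigh _ k hk, Finset.mul_sum]
      -- The Riccati equation, after clearing the denominator `d k - d j`.
      have key : ∀ j : Fin (n + 1), (d k : ℂ) * (w k j * F k j) + S k j
          = w k j * F k j * d j + ∑ i : Fin (n + 1), w k i * F k i * S i j := by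
        intro j
        have hne : (d k : ℂ) - d j ≠ 0 := by
          have : d j < d k := hd (by have := j.2; omega)
          rw [← Complex.ofReal_sub]
          exact_mod_cast (sub_pos.2 this).ne'
        have hwk : (w k j : ℂ) = ((d k : ℂ) - d j)⁻¹ := by
          rw [hw_def, gapWeight, if_pos ⟨by have := j.2; omega, hk⟩]
          push_cast
          rfl
        have h3 : ((d k : ℂ) - d j) * (w k j * F k j) = F k j := by
          rw [hwk, ← mul_assoc, mul_inv_cancel₀ hne, one_mul]
        have h4 : F k j = -S k j + ∑ i : Fin (n + 1), w k i * F k i * S i j := hfix k j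
        linear_combination h3 + h4
      have e : ∀ i : Fin (n + 1), (B v) i = d i * v i + ∑ j : Fin (n + 1), S i j * v j :=
        fun _ => rfl
      calc _ = ∑ j : Fin (n + 1), ((d k : ℂ) * (w k j * F k j) + S k j) * v j := by
            rw [← Finset.sum_add_distrib]
            exact Finset.sum_congr rfl fun _ _ => by ring
        _ = ∑ j : Fin (n + 1), (w k j * F k j * d j * v j)
            + ∑ j : Fin (n + 1), ∑ i : Fin (n + 1), w k i * F k i * S i j * v j := by
            rw [← Finset.sum_add_distrib]
            refine Finset.sum_congr rfl fun j _ => ?_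
            rw [key, add_mul, Finset.sum_mul]
        _ = _ := by
            rw [Finset.sum_comm, ← Finset.sum_add_distrib]
            refine Finset.sum_congr rfl fun i _ => ?_
            rw [e, mul_add, Finset.mul_sum]
            congr 1
            · ring
            · exact Finset.sum_congr rfl fun _ _ => by ring
  refine ⟨E, B, fun v v' h => ?_, hEs, hinv, fun u z a hu hz h => ?_, fun z v hz h => ?_⟩
  · funext i
    rw [← hElow v i, ← hElow v' i, h]
  -- Subtracting the graph element with the same low coordinates leaves `u'`, supported on `k > n`;
  -- it remains to show `u' = 0`.
  · set v : Fin (n + 1) → ℂ := fun i => u i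
    refine ⟨v, ?_⟩
    set u' : ℕ → ℂ := u - E v with hu'
    have hu's : Summable fun k => ‖u' k‖ :=
      Summable.of_nonneg_of_le (fun _ => norm_nonneg _) (fun k => norm_sub_le _ _)
        (hu.add (hEs v))
    have hlow : ∀ i : Fin (n + 1), u' i = 0 := fun i => by simp [hu', hElow, v]
    have hQu : ∀ {x : ℕ → ℂ}, (Summable fun k => ‖x k‖) → ∀ j,
        Summable fun k => ‖Q j k * x k‖ := fun {x} hx j =>
      Summable.of_nonneg_of_le (fun _ => norm_nonneg _) (fun k => by
        rw [norm_mul]; gcongr; exact hQ j k) (hx.mul_left A)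
    set p : ℕ → ℂ := fun j => ∑' k, Q j k * u' k with hp
    have hpn : ∀ j, ‖p j‖ ≤ A * ∑' k, ‖u' k‖ := fun j => by
      refine (norm_tsum_le_tsum_norm (hQu hu's j)).trans ?_
      rw [← tsum_mul_left]
      refine (hQu hu's j).tsum_le_tsum (fun k => ?_) (hu's.mul_left A)
      rw [norm_mul]; gcongr; exact hQ j k
    set a' := z • v + a - B v with ha'
    have heq : ∀ j, d j * u' j + p j = z * u' j + E a' j := by
      intro j
      have e1 : p j = (∑' k, Q j k * u k) - ∑' k, Q j k * E v k := by
        rw [hp, ← Summable.tsum_sub (hQu hu j).of_norm (hQu (hEs v) j).of_norm]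
        exact tsum_congr fun k => by simp [hu', mul_sub]
      have e2 : E a' j = z * E v j + E a j - E (B v) j := by simp [ha']
      rw [e1, e2]
      simp only [hu', Pi.sub_apply]
      linear_combination h j - hinv v j
    -- The low rows determine `a'` by `u'`, so the high rows become a closed equation for `u'`.
    have ha'p : ∀ i : Fin (n + 1), a' i = p i := fun i => by
      have := heq i
      rw [hlow, hElow] at this
      simpa using this.symm
    set U := ∑' k, ‖u' k‖ with hU
    have hU0 : 0 ≤ U := tsum_nonneg fun _ => norm_nonneg _
    have hbound : ∀ k, ‖u' k‖ ≤ 4 * A * U * |d k - d n|⁻¹ := by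
      intro k
      rcases le_or_gt k n with hk | hk
      · have := hlow ⟨k, by omega⟩
        simp only at this
        rw [this, norm_zero]
        positivity
      · obtain ⟨hz1, hz2⟩ := norm_sub_inv_le_of_lt hd hd0 hz hk
        have e : ((d k : ℂ) - z) * u' k = -p k + ∑ j : Fin (n + 1), w k j * F k j * p j := by
          have := heq k
          rw [hEhigh a' k hk] at this
          simp_rw [ha'p] at this
          linear_combination this
        have hn : ‖(d k : ℂ) - z‖ * ‖u' k‖ ≤ 2 * A * U := by
          rw [← norm_mul, e]
          refine (norm_add_le _ _).trans ?_
          rw [norm_neg]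
          calc _ ≤ A * U + ∑ j : Fin (n + 1), w k j * (2 * A * (A * U)) := by
                refine add_le_add (hpn k) (norm_sum_le_of_le _ fun j _ => ?_)
                rw [norm_mul, norm_mul, Complex.norm_real, Real.norm_of_nonneg (hw k j), mul_assoc]
                gcongr
                exacts [hw k j, hF k j, hpn j]
            _ ≤ A * U + τ * (2 * A * (A * U)) := by
                rw [← Finset.sum_mul]
                gcongr
                exact hr k
            _ ≤ _ := by
                have : 0 ≤ A * U := by positivity
                nlinarith
        calc ‖u' k‖ = ‖(d k : ℂ) - z‖⁻¹ * (‖(d k : ℂ) - z‖ * ‖u' k‖) := by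
              rw [← mul_assoc, inv_mul_cancel₀ hz1.ne', one_mul]
          _ ≤ (2 * |d k - d n|⁻¹) * (2 * A * U) := by gcongr
          _ = _ := by ring
    have hUle : U ≤ 4 * A * U * τ := by
      calc U ≤ ∑' k, 4 * A * U * |d k - d n|⁻¹ := hu's.tsum_le_tsum hbound (h1.mul_left _)
        _ = 4 * A * U * ∑' k, |d k - d n|⁻¹ := tsum_mul_left
        _ ≤ _ := by gcongr
    -- Here `4 A τ ≤ 1/2`, so `U ≤ U / 2`.
    have hUz : U = 0 := by nlinarith
    funext k
    have : ‖u' k‖ = 0 := le_antisymm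
      (by rw [← hUz]; exact hu's.le_tsum k fun _ _ => norm_nonneg _) (norm_nonneg _)
    exact sub_eq_zero.1 (norm_eq_zero.1 this)
  · set V := ∑ i : Fin (n + 1), ‖v i‖ with hV
    have hV0 : 0 ≤ V := Finset.sum_nonneg fun _ _ => norm_nonneg _
    have hbound : ∀ i : Fin (n + 1), ‖v i‖ ≤ 4 * A * V * |d i - d (n + 1)|⁻¹ := by
      intro i
      obtain ⟨hz1, hz2⟩ := norm_sub_inv_le_of_le hd hd0 hz (Nat.le_of_lt_succ i.2)
      have e : ((d i : ℂ) - z) * v i = -∑ j : Fin (n + 1), S i j * v j := by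
        have : (d i : ℂ) * v i + ∑ j : Fin (n + 1), S i j * v j = z * v i := congrFun h i
        linear_combination this
      have hn : ‖(d i : ℂ) - z‖ * ‖v i‖ ≤ 2 * A * V := by
        rw [← norm_mul, e, norm_neg, hV, Finset.mul_sum]
        refine norm_sum_le_of_le _ fun j _ => ?_
        rw [norm_mul]
        gcongr
        exact hS i j
      calc ‖v i‖ = ‖(d i : ℂ) - z‖⁻¹ * (‖(d i : ℂ) - z‖ * ‖v i‖) := by
            rw [← mul_assoc, inv_mul_cancel₀ hz1.ne', one_mul]
        _ ≤ (2 * |d i - d (n + 1)|⁻¹) * (2 * A * V) := by gcongr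
        _ = _ := by ring
    have hVle : V ≤ 4 * A * V * τ := by
      calc V ≤ ∑ i : Fin (n + 1), 4 * A * V * |d i - d (n + 1)|⁻¹ :=
            Finset.sum_le_sum fun i _ => hbound i
        _ = 4 * A * V * ∑ i : Fin (n + 1), |d i - d (n + 1)|⁻¹ :=
            (Finset.mul_sum _ _ _).symm
        _ ≤ _ := by
            gcongr
            exact (sum_fin_le_tsum h2 (fun _ => by positivity) _).trans h2τ
    have hVz : V = 0 := by nlinarith
    funext i
    exact norm_eq_zero.1 ((Finset.sum_eq_zero_iff_of_nonneg fun _ _ => norm_nonneg _).1 hVz i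
      (Finset.mem_univ i))

/-- An eigenvector for `z` in the annulus around `d (n + 1)` is concentrated at `n + 1`. -/
theorem concentration (hd : StrictMono d) (hd0 : ∀ k, 0 ≤ d k)
    {Q : ℕ → ℕ → ℂ} {A : ℝ} (hQ : ∀ i j, ‖Q i j‖ ≤ A)
    (h1 : Summable fun k => |d k - d (n + 1)|⁻¹) (h1τ : ∑' k, |d k - d (n + 1)|⁻¹ ≤ τ)
    (hAτ : A * τ ≤ 1 / 8) {u : ℕ → ℂ} (hu : Summable fun k => ‖u k‖) {z : ℂ}
    (hz1 : (d n + d (n + 1)) / 2 ≤ ‖z‖) (hz2 : ‖z‖ ≤ (d (n + 1) + d (n + 2)) / 2)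
    (h : ∀ j, d j * u j + ∑' k, Q j k * u k = z * u j) :
    ∑' k, ‖u k - (if k = n + 1 then u (n + 1) else 0)‖ ≤ 4 * A * τ * ‖u (n + 1)‖ ∧
      (u (n + 1) ≠ 0 → (d n + d (n + 1)) / 2 ≤ z.re) := by
  have hA : 0 ≤ A := (norm_nonneg _).trans (hQ 0 0)
  have hτ0 : 0 ≤ τ := (tsum_nonneg fun l => by positivity).trans h1τ
  have hAτ0 : 0 ≤ A * τ := mul_nonneg hA hτ0
  set U := ∑' k, ‖u k‖ with hU
  have hU0 : 0 ≤ U := tsum_nonneg fun _ => norm_nonneg _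
  have hQu : ∀ j, Summable fun k => ‖Q j k * u k‖ := fun j =>
    Summable.of_nonneg_of_le (fun _ => norm_nonneg _) (fun k => by
      rw [norm_mul]; gcongr; exact hQ j k) (hu.mul_left A)
  have hn : ∀ k, ‖(d k : ℂ) - z‖ * ‖u k‖ ≤ A * U := fun k => by
    have e : ((d k : ℂ) - z) * u k = -∑' j, Q k j * u j := by linear_combination h k
    rw [← norm_mul, e, norm_neg]
    refine (norm_tsum_le_tsum_norm (hQu k)).trans ?_
    rw [← tsum_mul_left]
    refine (hQu k).tsum_le_tsum (fun j => ?_) (hu.mul_left A)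
    rw [norm_mul]; gcongr; exact hQ k j
  have hbound : ∀ k, ‖u k - (if k = n + 1 then u (n + 1) else 0)‖
      ≤ 2 * A * U * |d k - d (n + 1)|⁻¹ := by
    intro k
    split_ifs with hk
    · subst hk
      simp
    · have hsep : 0 < ‖(d k : ℂ) - z‖ ∧ ‖(d k : ℂ) - z‖⁻¹ ≤ 2 * |d k - d (n + 1)|⁻¹ := by
        rcases lt_or_gt_of_ne hk with hk | hk
        · exact norm_sub_inv_le_of_le hd hd0 hz1 (Nat.le_of_lt_succ hk)
        · exact norm_sub_inv_le_of_lt hd hd0 hz2 hk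
      rw [sub_zero]
      calc ‖u k‖ = ‖(d k : ℂ) - z‖⁻¹ * (‖(d k : ℂ) - z‖ * ‖u k‖) := by
            rw [← mul_assoc, inv_mul_cancel₀ hsep.1.ne', one_mul]
        _ ≤ (2 * |d k - d (n + 1)|⁻¹) * (A * U) :=
            mul_le_mul hsep.2 (hn k) (by positivity) (by positivity)
        _ = _ := by ring
  have hrs : Summable fun k => ‖u k - (if k = n + 1 then u (n + 1) else 0)‖ :=
    Summable.of_nonneg_of_le (fun _ => norm_nonneg _) hbound (h1.mul_left _)
  set R := ∑' k, ‖u k - (if k = n + 1 then u (n + 1) else 0)‖ with hR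
  have hRle : R ≤ 2 * A * U * τ := by
    calc R ≤ ∑' k, 2 * A * U * |d k - d (n + 1)|⁻¹ := hrs.tsum_le_tsum hbound (h1.mul_left _)
      _ = 2 * A * U * ∑' k, |d k - d (n + 1)|⁻¹ := tsum_mul_left
      _ ≤ _ := by gcongr
  have hUR : U ≤ R + ‖u (n + 1)‖ := by
    have h3 : HasSum (fun k => if k = n + 1 then ‖u (n + 1)‖ else 0) ‖u (n + 1)‖ :=
      hasSum_ite_eq _ _
    rw [← h3.tsum_eq, hR, ← hrs.tsum_add h3.summable]
    refine hu.tsum_le_tsum (fun k => ?_) (hrs.add h3.summable)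
    split_ifs with hk
    · subst hk; simp
    · simp
  have hU2 : U ≤ 2 * ‖u (n + 1)‖ := by nlinarith
  refine ⟨hRle.trans (by nlinarith), fun hne => ?_⟩
  have hpos : 0 < ‖u (n + 1)‖ := norm_pos_iff.2 hne
  have h4 : ‖(d (n + 1) : ℂ) - z‖ ≤ 2 * A := by
    have h5 := (hn (n + 1)).trans (mul_le_mul_of_nonneg_left hU2 hA)
    refine le_of_mul_le_mul_right ?_ hpos
    linarith
  have hgap : d n < d (n + 1) := hd n.lt_succ_self
  -- A single term of the gap sum already forces a gap large compared with `A`. As `z` is within `2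
  -- A` of `d (n + 1)`, its real part cannot fall below the midpoint.
  have h6 : (d (n + 1) - d n)⁻¹ ≤ τ := by
    have := (h1.le_tsum n fun _ _ => by positivity).trans h1τ
    rwa [abs_sub_comm, abs_of_pos (sub_pos.2 hgap)] at this
  have h7 : 4 * A ≤ d (n + 1) - d n := by
    have h8 : A * (d (n + 1) - d n)⁻¹ ≤ 1 / 8 := (mul_le_mul_of_nonneg_left h6 hA).trans hAτ
    rw [← div_eq_mul_inv, div_le_iff₀ (sub_pos.2 hgap)] at h8
    linarith
  have h9 := (Complex.abs_re_le_norm _).trans h4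
  rw [Complex.sub_re, Complex.ofReal_re, abs_le] at h9
  linarith [h9.2]

end InvariantSubspace

/-! ### Listings ordered by real part, located by modulus -/

section Listing

/-- `Λ` lists each `z` exactly `μ z` times, by nondecreasing real parts. -/
def IsListing (μ : ℂ → ℕ∞) (Λ : ℕ → ℂ) : Prop :=
  (∀ z : ℂ, {i : ℕ | Λ i = z}.encard = μ z) ∧ Monotone fun i => (Λ i).re

theorem encard_succ_fiber (Λ : ℕ → ℂ) (z : ℂ) :
    {n : ℕ | 1 ≤ n ∧ Λ n = z}.encard = {i : ℕ | Λ (i + 1) = z}.encard := by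
  have : {n : ℕ | 1 ≤ n ∧ Λ n = z} = (fun i => i + 1) '' {i : ℕ | Λ (i + 1) = z} := by
    ext n
    constructor
    · rintro ⟨h1, h2⟩
      exact ⟨n - 1, by simpa [Nat.sub_add_cancel h1] using h2, Nat.sub_add_cancel h1⟩
    · rintro ⟨i, hi, rfl⟩
      exact ⟨Nat.le_add_left 1 i, hi⟩
  rw [this, (add_left_injective 1).encard_image]

variable {μ : ℂ → ℕ∞} {ρ : ℕ → ℝ} {N₀ : ℕ} {S : ℕ → Multiset ℂ}

/-- Both multisets count `μ` inside the smaller disc, so the first is contained in the second. The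
cardinalities differ by one, and the extra element cannot lie in the smaller disc, where the counts
agree. -/
theorem exists_cons (hρ : Monotone ρ) (hcard : ∀ N ≥ N₀, (S N).card = N)
    (hlt : ∀ N ≥ N₀, ∀ z ∈ S N, ‖z‖ < ρ N)
    (hcount : ∀ N ≥ N₀, ∀ z, ‖z‖ < ρ N → μ z = (S N).count z) (N : ℕ) (hN : N₀ ≤ N) :
    ∃ a, S (N + 1) = a ::ₘ S N ∧ ρ N ≤ ‖a‖ := by
  have hcc : ∀ z, ‖z‖ < ρ N → (S N).count z = (S (N + 1)).count z := fun z hz => by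
    have h1 := hcount N hN z hz
    rw [hcount (N + 1) (by omega) z (hz.trans_le (hρ N.le_succ))] at h1
    exact_mod_cast h1.symm
  have hle : S N ≤ S (N + 1) := Multiset.le_iff_count.2 fun z => by
    by_cases hz : z ∈ S N
    · exact (hcc z (hlt N hN z hz)).le
    · simp [Multiset.count_eq_zero_of_notMem hz]
  obtain ⟨R, hR⟩ := Multiset.le_iff_exists_add.1 hle
  have hRc : R.card = 1 := by
    have := congrArg Multiset.card hR
    rw [Multiset.card_add, hcard N hN, hcard (N + 1) (by omega)] at this
    omega
  obtain ⟨a, rfl⟩ := Multiset.card_eq_one.1 hRc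
  refine ⟨a, by rw [hR, add_comm, Multiset.singleton_add], ?_⟩
  by_contra! h
  have := hcc a h
  rw [hR, Multiset.count_add, Multiset.count_singleton_self] at this
  omega

/-- Sort the finitely many values of `S N₀` by real part, then append the new element of each larger
disc. A new element lies outside the previous disc, so by `hre` its real part is at least that
radius, hence at least every earlier real part. -/
theorem exists_isListing (hρ : Monotone ρ) (hρt : Filter.Tendsto ρ Filter.atTop Filter.atTop)
    (hcard : ∀ N ≥ N₀, (S N).card = N) (hlt : ∀ N ≥ N₀, ∀ z ∈ S N, ‖z‖ < ρ N)
    (hcount : ∀ N ≥ N₀, ∀ z, ‖z‖ < ρ N → μ z = (S N).count z)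
    (hre : ∀ N ≥ N₀, ∀ z, μ z ≠ 0 → ρ N ≤ ‖z‖ → ρ N ≤ z.re) :
    ∃ Λ, IsListing μ Λ := by
  have hcons := exists_cons hρ hcard hlt hcount
  choose! a haS haρ using hcons
  have hμS : ∀ N ≥ N₀, ∀ z ∈ S N, μ z ≠ 0 := fun N hN z hz => by
    rw [hcount N hN z (hlt N hN z hz)]
    exact_mod_cast (Multiset.count_pos.2 hz).ne'
  have haS' : ∀ N ≥ N₀, a N ∈ S (N + 1) := fun N hN => by
    rw [haS N hN]; exact Multiset.mem_cons_self _ _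
  let L := (S N₀).toList.insertionSort (fun x y => x.re ≤ y.re)
  have hLS : (L : Multiset ℂ) = S N₀ := by
    rw [← Multiset.coe_toList (S N₀)]
    exact Multiset.coe_eq_coe.2 (List.perm_insertionSort _ _)
  have hLlen : L.length = N₀ := by
    rw [← hcard N₀ le_rfl, ← hLS, Multiset.coe_card]
  have hLsort : L.Pairwise (fun x y => x.re ≤ y.re) := by
    have : Std.Total (fun x y : ℂ => x.re ≤ y.re) := ⟨fun x y => le_total _ _⟩
    have : IsTrans ℂ (fun x y : ℂ => x.re ≤ y.re) := ⟨fun x y z => le_trans⟩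
    exact List.pairwise_insertionSort _ _
  let Λ : ℕ → ℂ := fun i => if h : i < L.length then L[i] else a i
  have hmap : ∀ M ≥ N₀, Multiset.map Λ (Multiset.range M) = S M := by
    intro M hM
    induction M, hM using Nat.le_induction with
    | base =>
      rw [← hLS, Multiset.range, Multiset.map_coe]
      congr 1
      refine List.ext_getElem (by simp [hLlen]) fun i h1 h2 => ?_
      simp [Λ, h2]
    | succ M hM ih =>
      rw [Multiset.range_succ, Multiset.map_cons, ih, haS M hM]
      simp [Λ, hLlen, hM]
  have hΛS : ∀ i, ∀ M ≥ N₀, i < M → Λ i ∈ S M := fun i M hM hi => by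
    rw [← hmap M hM]
    exact Multiset.mem_map_of_mem _ (by simpa using hi)
  refine ⟨Λ, fun z => ?_, monotone_nat_of_le_succ fun i => ?_⟩
  · obtain ⟨M, hM, hzM⟩ : ∃ M ≥ N₀, ‖z‖ < ρ M := by
      obtain ⟨M, h1, h2⟩ :=
        ((Filter.eventually_ge_atTop N₀).and (hρt.eventually_gt_atTop ‖z‖)).exists
      exact ⟨M, h1, h2⟩
    have hset : {i | Λ i = z} = ↑((Finset.range M).filter fun i => z = Λ i) := by
      ext i
      simp only [mem_ofPred_eq, Finset.coe_filter, Finset.mem_range]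
      refine ⟨fun h => ⟨?_, h.symm⟩, fun h => h.2.symm⟩
      by_contra! hi
      have : Λ i = a i := dif_neg (by omega)
      have h2 := haρ i (by omega)
      rw [← this, h] at h2
      exact absurd (hzM.trans_le ((hρ hi).trans h2)) (lt_irrefl _)
    rw [hset, Set.encard_coe_eq_coe_finsetCard, hcount M hM z hzM, ← hmap M hM,
      Multiset.count_map]
    rfl
  · rcases lt_or_ge (i + 1) N₀ with hi | hi
    · have h1 : Λ i = L[i] := dif_pos (by omega)
      have h2 : Λ (i + 1) = L[i + 1] := dif_pos (by omega)
      rw [h1, h2]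
      exact List.pairwise_iff_getElem.1 hLsort _ _ _ _ i.lt_succ_self
    · have h1 := hlt (i + 1) hi _ (hΛS i (i + 1) hi i.lt_succ_self)
      have h3 : Λ (i + 1) = a (i + 1) := dif_neg (by omega)
      have h4 := hre (i + 1) hi _ (hμS _ (by omega) _ (haS' (i + 1) hi)) (haρ (i + 1) hi)
      rw [h3]
      exact ((Complex.re_le_norm _).trans h1.le).trans h4

/-- The indices whose entry lies in the disc of radius `ρ M` number exactly `M` and form an initial
segment of `ℕ`, so they are the indices below `M`. Comparing the discs for `i` and `i + 1` isolates
the entry `i`. -/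
theorem IsListing.annulus {Λ : ℕ → ℂ} (hΛ : IsListing μ Λ)
    (hcard : ∀ N ≥ N₀, (S N).card = N) (hlt : ∀ N ≥ N₀, ∀ z ∈ S N, ‖z‖ < ρ N)
    (hcount : ∀ N ≥ N₀, ∀ z, ‖z‖ < ρ N → μ z = (S N).count z)
    (hre : ∀ N ≥ N₀, ∀ z, μ z ≠ 0 → ρ N ≤ ‖z‖ → ρ N ≤ z.re) {i : ℕ} (hi : N₀ ≤ i) :
    μ (Λ i) ≠ 0 ∧ ρ i ≤ ‖Λ i‖ ∧ ‖Λ i‖ < ρ (i + 1) := by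
  have hμ : ∀ i, μ (Λ i) ≠ 0 := fun i => by
    rw [← hΛ.1, Set.encard_ne_zero]
    exact ⟨i, rfl⟩
  have key : ∀ M ≥ N₀, ∀ i, ‖Λ i‖ < ρ M ↔ i < M := by
    intro M hM
    have hfib : ∀ z ∈ S M, {i : ℕ | Λ i = z}.encard = (S M).count z := fun z hz => by
      rw [hΛ.1, hcount M hM z (hlt M hM z hz)]
    have hTeq : {i | ‖Λ i‖ < ρ M} = ⋃ z ∈ (S M).toFinset, {i : ℕ | Λ i = z} := by
      ext i
      simp only [mem_ofPred_eq, mem_iUnion, Multiset.mem_toFinset, exists_prop, exists_eq_right']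
      refine ⟨fun h => ?_, hlt M hM _⟩
      have h1 := hμ i
      rw [hcount M hM _ h] at h1
      exact Multiset.count_pos.1 (Nat.pos_of_ne_zero (by exact_mod_cast h1))
    have hfin : {i | ‖Λ i‖ < ρ M}.Finite := by
      rw [hTeq]
      refine Set.Finite.biUnion (Finset.finite_toSet _) fun z hz => ?_
      refine Set.finite_of_encard_eq_coe (hfib z ?_)
      simpa using hz
    have hmem : ∀ i, i ∈ hfin.toFinset ↔ ‖Λ i‖ < ρ M := fun i => by simp
    have hcardT : hfin.toFinset.card = M := by
      rw [Finset.card_eq_sum_card_fiberwise (f := Λ) (t := (S M).toFinset)]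
      · conv_rhs => rw [← hcard M hM, ← Multiset.toFinset_sum_count_eq]
        refine Finset.sum_congr rfl fun z hz => ?_
        have hz' : z ∈ S M := by simpa using hz
        have h2 : {i : ℕ | Λ i = z} = ↑(hfin.toFinset.filter fun i => Λ i = z) := by
          ext i
          simp only [mem_ofPred_eq, Finset.coe_filter, hmem]
          exact ⟨fun h => ⟨h ▸ hlt M hM z hz', h⟩, fun h => h.2⟩
        have h3 := hfib z hz'
        rw [h2, Set.encard_coe_eq_coe_finsetCard] at h3
        exact_mod_cast h3
      · intro i hi
        have : i ∈ {i | ‖Λ i‖ < ρ M} := by simpa using hi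
        rw [hTeq] at this
        simpa using this
    -- An earlier entry outside the disc would have real part at least `ρ M`, while the later one,
    -- inside, has real part below `ρ M`.
    have hdown : ∀ i ∈ hfin.toFinset, ∀ j ≤ i, j ∈ hfin.toFinset := by
      intro i hi j hj
      rw [hmem] at hi ⊢
      by_contra! h
      have h1 := hre M hM _ (hμ j) h
      have h2 := hΛ.2 hj
      simp only at h2
      linarith [Complex.re_le_norm (Λ i)]
    have hsub : hfin.toFinset ⊆ Finset.range M := fun i hi => by
      have : Finset.range (i + 1) ⊆ hfin.toFinset := fun j hj =>
        hdown i hi j (Nat.le_of_lt_succ (Finset.mem_range.1 hj))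
      have := Finset.card_le_card this
      rw [Finset.card_range, hcardT] at this
      exact Finset.mem_range.2 this
    have := Finset.eq_of_subset_of_card_le hsub (by rw [hcardT, Finset.card_range])
    intro i
    rw [← hmem, this, Finset.mem_range]
  refine ⟨hμ i, ?_, (key (i + 1) (by omega) i).2 i.lt_succ_self⟩
  by_contra! h
  exact absurd ((key i hi i).1 h) (lt_irrefl _)

end Listing

/-! ### Sums of reciprocal gaps between unperturbed eigenvalues -/

section Gaps

/-- The eigenvalues of the unperturbed problem. -/
noncomputable def freeEigenvalue (b : Boundary) (m k : ℕ) : ℝ := b.freq (k + 1) ^ (2 * m)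

theorem freq_succ_sub (b : Boundary) (k n : ℕ) :
    b.freq (k + 1) - b.freq (n + 1) = (k : ℝ) - n := by
  cases b <;> simp [Boundary.freq]

theorem le_freq_succ (b : Boundary) (k : ℕ) : ((k : ℝ) + 1) / 2 ≤ b.freq (k + 1) := by
  have : (0 : ℝ) ≤ k := k.cast_nonneg
  cases b <;> simp only [Boundary.freq] <;> push_cast <;> linarith

theorem freq_succ_pos (b : Boundary) (k : ℕ) : 0 < b.freq (k + 1) :=
  lt_of_lt_of_le (by positivity) (le_freq_succ b k)

theorem freeEigenvalue_pos (b : Boundary) (m k : ℕ) : 0 < freeEigenvalue b m k :=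
  pow_pos (freq_succ_pos b k) _

theorem strictMono_freeEigenvalue (b : Boundary) {m : ℕ} (hm : 1 ≤ m) :
    StrictMono (freeEigenvalue b m) := strictMono_nat_of_lt_succ fun k => by
  refine pow_lt_pow_left₀ ?_ (freq_succ_pos b k).le (by omega)
  have := freq_succ_sub b (k + 1) k
  push_cast at this
  linarith

theorem inv_le_freeEigenvalue (b : Boundary) {m : ℕ} (hm : 1 ≤ m) (k : ℕ) :
    (freeEigenvalue b m k)⁻¹ ≤ 4 ^ m * (((k : ℝ) + 1) ^ 2)⁻¹ := by
  have h1 := le_freq_succ b k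
  have h2 : (((k : ℝ) + 1) / 2) ^ (2 * m) ≤ freeEigenvalue b m k :=
    pow_le_pow_left₀ (by positivity) h1 _
  have h3 : ((k : ℝ) + 1) ^ 2 / 4 ^ m ≤ (((k : ℝ) + 1) / 2) ^ (2 * m) := by
    rw [div_pow, pow_mul 2, show (2 : ℝ) ^ 2 = 4 by norm_num]
    gcongr
    exacts [by linarith [(k.cast_nonneg : (0 : ℝ) ≤ k)], by omega]
  calc _ ≤ (((k : ℝ) + 1) ^ 2 / 4 ^ m)⁻¹ := inv_anti₀ (by positivity) (h3.trans h2)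
    _ = _ := by rw [inv_div, div_eq_mul_inv]

theorem summable_inv_freeEigenvalue (b : Boundary) {m : ℕ} (hm : 1 ≤ m) :
    Summable fun k => (freeEigenvalue b m k)⁻¹ := by
  refine Summable.of_nonneg_of_le (fun k => (inv_pos.2 (freeEigenvalue_pos b m k)).le)
    (inv_le_freeEigenvalue b hm) (Summable.mul_left _ ?_)
  have := (summable_nat_add_iff 1).2 (Real.summable_nat_pow_inv.2 (show 1 < 2 by norm_num))
  simpa using this

theorem tendsto_freeEigenvalue (b : Boundary) {m : ℕ} (hm : 1 ≤ m) :
    Filter.Tendsto (freeEigenvalue b m) Filter.atTop Filter.atTop := by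
  refine (Filter.tendsto_pow_atTop (by omega : 2 * m ≠ 0)).comp ?_
  refine Filter.tendsto_atTop_mono (le_freq_succ b) ?_
  exact (Filter.tendsto_atTop_add_const_right _ _ tendsto_natCast_atTop_atTop).atTop_div_const
    two_pos

theorem sub_mul_pow_le {x y : ℝ} (hx : 0 ≤ x) (hxy : x ≤ y) (p : ℕ) :
    (y - x) * y ^ p ≤ y ^ (p + 1) - x ^ (p + 1) := by
  have : x * x ^ p ≤ x * y ^ p := by gcongr
  rw [pow_succ', pow_succ']
  linarith

theorem sum_inv_le_log {N : ℕ} (hN : 2 ≤ N) {k : ℕ} (hk : k ≤ N) :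
    ∑ i ∈ Finset.range k, ((i : ℝ) + 1)⁻¹ ≤ 3 * Real.log N := by
  have h1 : ∑ i ∈ Finset.range N, ((i : ℝ) + 1)⁻¹ ≤ 1 + Real.log N := by
    have := harmonic_le_one_add_log N
    unfold harmonic at this
    push_cast at this
    exact this
  have h2 : ∑ i ∈ Finset.range k, ((i : ℝ) + 1)⁻¹ ≤ ∑ i ∈ Finset.range N, ((i : ℝ) + 1)⁻¹ :=
    Finset.sum_le_sum_of_subset_of_nonneg (Finset.range_mono hk) fun _ _ _ => by positivity
  -- Since `log 2 > 1/2`, the additive `1` in the harmonic bound is absorbed by `2 log N`.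
  have h3 : Real.log 2 ≤ Real.log N := Real.log_le_log two_pos (by exact_mod_cast hN)
  linarith [Real.log_two_gt_d9]

/-- Induction on the shift `N`: raising it by one adds a sum telescoping in `j`, which is at most
`1/(N + 1)`. -/
theorem sum_inv_sub_inv_le (N J : ℕ) :
    ∑ j ∈ Finset.range J, (((j : ℝ) + 1)⁻¹ - ((j : ℝ) + 1 + N)⁻¹)
      ≤ ∑ i ∈ Finset.range N, ((i : ℝ) + 1)⁻¹ := by
  induction N with
  | zero => simp
  | succ N ih =>
    rw [Finset.sum_range_succ]
    have e : ∑ j ∈ Finset.range J, (((j : ℝ) + 1 + N)⁻¹ - ((j : ℝ) + 1 + (N + 1 : ℕ))⁻¹)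
        ≤ ((N : ℝ) + 1)⁻¹ := by
      have h := Finset.sum_range_sub' (fun j : ℕ => ((j : ℝ) + 1 + N)⁻¹) J
      have h2 : ∀ j : ℕ, ((j : ℝ) + 1 + N)⁻¹ - ((j : ℝ) + 1 + (N + 1 : ℕ))⁻¹
          = ((j : ℝ) + 1 + N)⁻¹ - (((j + 1 : ℕ) : ℝ) + 1 + N)⁻¹ := fun j => by
        congr 2; push_cast; ring
      simp_rw [h2]
      rw [h]
      have : 0 ≤ ((J : ℝ) + 1 + N)⁻¹ := by positivity
      simp only [Nat.cast_zero, zero_add]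
      rw [add_comm (1 : ℝ)]
      linarith
    calc _ = ∑ j ∈ Finset.range J, (((j : ℝ) + 1)⁻¹ - ((j : ℝ) + 1 + N)⁻¹)
          + ∑ j ∈ Finset.range J, (((j : ℝ) + 1 + N)⁻¹ - ((j : ℝ) + 1 + (N + 1 : ℕ))⁻¹) := by
          rw [← Finset.sum_add_distrib]
          exact Finset.sum_congr rfl fun _ _ => by ring
      _ ≤ _ := add_le_add ih e

theorem sum_inv_mul_inv_le {N : ℕ} (hN : 2 ≤ N) (J : ℕ) :
    ∑ j ∈ Finset.range J, (((j : ℝ) + 1) * ((j : ℝ) + 1 + N))⁻¹ ≤ 3 * Real.log N / N := by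
  have hN0 : (0 : ℝ) < N := by exact_mod_cast (by omega : 0 < N)
  rw [le_div_iff₀ hN0, Finset.sum_mul]
  refine le_trans (le_of_eq ?_) ((sum_inv_sub_inv_le N J).trans (sum_inv_le_log hN le_rfl))
  refine Finset.sum_congr rfl fun j _ => ?_
  have h1 : (j : ℝ) + 1 ≠ 0 := by positivity
  have h2 : (j : ℝ) + 1 + N ≠ 0 := by positivity
  field_simp
  ring

/-- By `sub_mul_pow_le` a difference of `2m`-th powers dominates the difference of the bases times
the larger base to the power `2m - 1`. Below `n` this leaves a harmonic sum; above `n`, the sum of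
`1/((j + 1)(j + 1 + N))`, which is `O(log N / N)`. The assumption `1 ≤ n` keeps `log (n + 1)` away
from zero. -/
theorem gap_sum_le (b : Boundary) {m : ℕ} (hm : 1 ≤ m) {n : ℕ} (hn : 1 ≤ n) :
    (Summable fun k => |freeEigenvalue b m k - freeEigenvalue b m n|⁻¹) ∧
      ∑' k, |freeEigenvalue b m k - freeEigenvalue b m n|⁻¹
        ≤ 6 * 2 ^ (2 * m - 1) * (Real.log (n + 1 : ℕ) / ((n + 1 : ℕ) : ℝ) ^ (2 * m - 1)) := by
  obtain ⟨p, rfl⟩ : ∃ p, m = p + 1 := ⟨m - 1, by omega⟩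
  have hp : 2 * (p + 1) - 1 = 2 * p + 1 := by omega
  rw [hp]
  set N : ℕ := n + 1 with hN
  have hN2 : 2 ≤ N := by omega
  have hN0 : (0 : ℝ) < N := by positivity
  have hfn : (N : ℝ) / 2 ≤ b.freq (n + 1) := by
    have := le_freq_succ b n
    rw [hN]; push_cast; exact this
  have hfn0 := freq_succ_pos b n
  have hlog : 0 ≤ Real.log N := Real.log_nonneg (by exact_mod_cast (by omega : 1 ≤ N))
  set f : ℕ → ℝ := fun k => |freeEigenvalue b (p + 1) k - freeEigenvalue b (p + 1) n|⁻¹ with hf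
  have hf0 : ∀ k, 0 ≤ f k := fun k => by positivity
  have hmono := strictMono_freeEigenvalue b hm
  have hlow : ∀ k < n, f k ≤ ((n : ℝ) - k)⁻¹ * (2 ^ (2 * p + 1) / (N : ℝ) ^ (2 * p + 1)) := by
    intro k hk
    have hkn : (0 : ℝ) < n - k := sub_pos.2 (by exact_mod_cast hk)
    have h1 : ((n : ℝ) - k) * ((N : ℝ) / 2) ^ (2 * p + 1)
        ≤ freeEigenvalue b (p + 1) n - freeEigenvalue b (p + 1) k := by
      have h2 := freq_succ_sub b n k
      refine le_trans ?_ (sub_mul_pow_le (freq_succ_pos b k).le (by linarith) _)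
      rw [h2]
      exact mul_le_mul_of_nonneg_left (pow_le_pow_left₀ (by positivity) hfn _) hkn.le
    have h2 := hmono hk
    simp only [hf]
    rw [abs_sub_comm, abs_of_pos (sub_pos.2 h2)]
    refine (inv_anti₀ (by positivity) h1).trans (le_of_eq ?_)
    rw [mul_inv, div_pow, inv_div]
  -- One factor keeps its growth in `j`, to make the series converge; the other `2 * p` are bounded
  -- below by `N / 2`.
  have hhigh : ∀ j, f (j + (n + 1)) ≤ 2 * (2 ^ (2 * p) / (N : ℝ) ^ (2 * p))
      * (((j : ℝ) + 1) * ((j : ℝ) + 1 + N))⁻¹ := by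
    intro j
    have hlt : n < j + (n + 1) := by omega
    have h2 := freq_succ_sub b (j + (n + 1)) n
    have h3 := le_freq_succ b (j + (n + 1))
    push_cast at h2 h3
    have h4 : ((j : ℝ) + 1 + N) / 2 ≤ b.freq (j + (n + 1) + 1) := by
      refine le_trans (le_of_eq ?_) h3
      rw [hN]; push_cast; ring
    have h5 : b.freq (n + 1) ≤ b.freq (j + (n + 1) + 1) := by
      have : (0 : ℝ) ≤ j := j.cast_nonneg
      linarith
    have h1 : ((j : ℝ) + 1) * (((N : ℝ) / 2) ^ (2 * p) * (((j : ℝ) + 1 + N) / 2))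
        ≤ freeEigenvalue b (p + 1) (j + (n + 1)) - freeEigenvalue b (p + 1) n := by
      refine le_trans ?_ (sub_mul_pow_le hfn0.le h5 _)
      rw [show b.freq (j + (n + 1) + 1) - b.freq (n + 1) = (j : ℝ) + 1 by linarith, pow_succ]
      exact mul_le_mul_of_nonneg_left (mul_le_mul (pow_le_pow_left₀ (by positivity)
        (hfn.trans h5) _) h4 (by positivity) (pow_nonneg (hfn0.le.trans h5) _)) (by positivity)
    simp only [hf]
    rw [abs_of_pos (sub_pos.2 (hmono hlt))]
    refine (inv_anti₀ (by positivity) h1).trans (le_of_eq ?_)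
    rw [div_pow]
    field_simp
  have htail : Summable fun j => f (j + (n + 1)) := by
    refine summable_of_sum_range_le (fun j => hf0 _)
      (c := 2 * (2 ^ (2 * p) / (N : ℝ) ^ (2 * p)) * (3 * Real.log N / N)) fun J => ?_
    refine (Finset.sum_le_sum fun j _ => hhigh j).trans ?_
    rw [← Finset.mul_sum]
    gcongr
    exact sum_inv_mul_inv_le hN2 J
  have hsum : Summable f := (summable_nat_add_iff (n + 1)).1 htail
  refine ⟨hsum, ?_⟩
  rw [← hsum.sum_add_tsum_nat_add (n + 1), Finset.sum_range_succ]
  -- The convention `0⁻¹ = 0` removes the diagonal index from the sum.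
  have hfnn : f n = 0 := by simp [hf]
  rw [hfnn, add_zero]
  have h1 : ∑ k ∈ Finset.range n, f k
      ≤ 3 * Real.log N * (2 ^ (2 * p + 1) / (N : ℝ) ^ (2 * p + 1)) := by
    refine (Finset.sum_le_sum fun k hk => hlow k (Finset.mem_range.1 hk)).trans ?_
    rw [← Finset.sum_mul]
    gcongr
    rw [← Finset.sum_range_reflect]
    refine le_trans (le_of_eq (Finset.sum_congr rfl fun i hi => ?_))
      (sum_inv_le_log hN2 (show n ≤ N by omega))
    have : i < n := Finset.mem_range.1 hi
    rw [show n - 1 - i = n - (i + 1) by omega, Nat.cast_sub (by omega)]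
    push_cast
    congr 1
    ring
  have h2 : ∑' j, f (j + (n + 1))
      ≤ 2 * (2 ^ (2 * p) / (N : ℝ) ^ (2 * p)) * (3 * Real.log N / N) := by
    refine Real.tsum_le_of_sum_range_le (fun j => hf0 _) fun J => ?_
    refine (Finset.sum_le_sum fun j _ => hhigh j).trans ?_
    rw [← Finset.mul_sum]
    gcongr
    exact sum_inv_mul_inv_le hN2 J
  refine (add_le_add h1 h2).trans (le_of_eq ?_)
  field_simp
  ring

theorem tendsto_log_div_pow {p : ℕ} (hp : 1 ≤ p) :
    Filter.Tendsto (fun n : ℕ => Real.log n / (n : ℝ) ^ p) Filter.atTop (nhds 0) := by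
  have h1 : Filter.Tendsto (fun n : ℕ => Real.log n / (n : ℝ)) Filter.atTop (nhds 0) :=
    Real.isLittleO_log_id_atTop.tendsto_div_nhds_zero.comp tendsto_natCast_atTop_atTop
  refine squeeze_zero' (Filter.Eventually.of_forall fun n => ?_) ?_ h1
  · exact div_nonneg (Real.log_natCast_nonneg n) (by positivity)
  · filter_upwards [Filter.eventually_ge_atTop 1] with n hn
    have hn1 : (1 : ℝ) ≤ n := by exact_mod_cast hn
    have := Real.log_natCast_nonneg n
    gcongr
    exact le_self_pow₀ hn1 (by omega)

end Gaps

/-! ### The unperturbed modes: orthonormality, completeness, synthesis -/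

section Modes

/-- The normalized eigenfunctions of the unperturbed problem. -/
noncomputable def mode (b : Boundary) (k : ℕ) (x : ℝ) : ℝ := √(2 / π) * Real.sin (b.freq (k + 1) * x)

/-- The generalized Fourier coefficients. -/
noncomputable def coef (b : Boundary) (f : ℝ → ℂ) (k : ℕ) : ℂ := ∫ x in (0 : ℝ)..π, f x * mode b k x

theorem continuous_mode (b : Boundary) (k : ℕ) : Continuous (mode b k) := by
  unfold mode; fun_prop

theorem continuous_mode_complex (b : Boundary) (k : ℕ) : Continuous fun x => (mode b k x : ℂ) :=
  Complex.continuous_ofReal.comp (continuous_mode b k)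

theorem norm_mode_le (b : Boundary) (k : ℕ) (x : ℝ) : ‖(mode b k x : ℂ)‖ ≤ √(2 / π) := by
  rw [Complex.norm_real, mode, norm_mul, Real.norm_of_nonneg (Real.sqrt_nonneg _)]
  exact mul_le_of_le_one_right (Real.sqrt_nonneg _) (Real.abs_sin_le_one _)

theorem integral_cos_int_mul (n : ℤ) :
    ∫ x in (0 : ℝ)..π, Real.cos (n * x) = if n = 0 then π else 0 := by
  split_ifs with h
  · simp [h]
  · have hn : (n : ℝ) ≠ 0 := by exact_mod_cast h
    rw [intervalIntegral.integral_comp_mul_left _ hn]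
    simp [Real.sin_int_mul_pi]

theorem integral_mode_mul_mode (b : Boundary) (j k : ℕ) :
    ∫ x in (0 : ℝ)..π, mode b j x * mode b k x = if j = k then 1 else 0 := by
  obtain ⟨s, hs, hs0⟩ : ∃ s : ℤ, b.freq (j + 1) + b.freq (k + 1) = s ∧ s ≠ 0 := by
    cases b
    · refine ⟨j + k + 2, ?_, by omega⟩
      simp only [Boundary.freq]; push_cast; ring
    · refine ⟨j + k + 1, ?_, by omega⟩
      simp only [Boundary.freq]; push_cast; ring
  have hd : b.freq (j + 1) - b.freq (k + 1) = ((j - k : ℤ) : ℝ) := by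
    rw [freq_succ_sub]; push_cast; rfl
  have e : ∀ x, mode b j x * mode b k x
      = (1 / π) * (Real.cos ((j - k : ℤ) * x) - Real.cos (s * x)) := by
    intro x
    have h2 : √(2 / π) * √(2 / π) = 2 / π := Real.mul_self_sqrt (by positivity)
    rw [← hs, ← hd, sub_mul, add_mul, Real.cos_sub, Real.cos_add]
    unfold mode
    linear_combination (Real.sin (b.freq (j + 1) * x) * Real.sin (b.freq (k + 1) * x)) * h2
  simp_rw [e]
  rw [intervalIntegral.integral_const_mul, intervalIntegral.integral_sub
    ((by fun_prop : Continuous _).intervalIntegrable _ _)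
    ((by fun_prop : Continuous _).intervalIntegrable _ _), integral_cos_int_mul,
    integral_cos_int_mul, if_neg hs0]
  by_cases h : j = k
  · simp [h, Real.pi_ne_zero]
  · rw [if_neg h, if_neg (by omega)]
    simp

theorem coef_mode (b : Boundary) (j k : ℕ) :
    coef b (fun x => (mode b j x : ℂ)) k = if j = k then 1 else 0 := by
  unfold coef
  have := congrArg (fun r : ℝ => (r : ℂ)) (integral_mode_mul_mode b j k)
  rw [← intervalIntegral.integral_ofReal] at this
  simp only [Complex.ofReal_mul, apply_ite Complex.ofReal, Complex.ofReal_one,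
    Complex.ofReal_zero] at this
  exact this

theorem two_cos_mul_mode_succ (b : Boundary) (k : ℕ) (x : ℝ) :
    2 * Real.cos x * mode b (k + 1) x = mode b (k + 2) x + mode b k x := by
  have h1 : b.freq (k + 2 + 1) * x = b.freq (k + 1 + 1) * x + x := by
    have := freq_succ_sub b (k + 2) (k + 1)
    push_cast at this
    linear_combination x * this
  have h2 : b.freq (k + 1) * x = b.freq (k + 1 + 1) * x - x := by
    have := freq_succ_sub b k (k + 1)
    push_cast at this
    linear_combination x * this
  unfold mode
  rw [h1, h2, Real.sin_add, Real.sin_sub]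
  ring

/-- The three-term recurrence continued to index `-1`: there the frequency would be `0` for
Dirichlet and `-1/2` for Dirichlet–Neumann, giving `c = 0` and `c = -1`. -/
theorem two_cos_mul_mode_zero (b : Boundary) :
    ∃ c : ℝ, ∀ x, 2 * Real.cos x * mode b 0 x = mode b 1 x + c * mode b 0 x := by
  cases b
  · refine ⟨0, fun x => ?_⟩
    have : ((1 + 1 : ℕ) : ℝ) * x = 2 * x := by norm_num
    simp only [mode, Boundary.freq]
    rw [this, Real.sin_two_mul]
    norm_num
    ring
  · refine ⟨-1, fun x => ?_⟩
    simp only [mode, Boundary.freq]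
    have h1 : (((1 + 1 : ℕ) : ℝ) - 1 / 2) * x = x + x / 2 := by push_cast; ring
    have h2 : (((0 + 1 : ℕ) : ℝ) - 1 / 2) * x = x - x / 2 := by push_cast; ring
    have h3 : x - x / 2 = x / 2 := by ring
    have h4 : Real.sin (x / 2) = Real.sin x * Real.cos (x / 2) - Real.cos x * Real.sin (x / 2) := by
      rw [← Real.sin_sub, h3]
    rw [h1, h2, Real.sin_add, h3]
    linear_combination √(2 / π) * h4

theorem mode_zero_pos (b : Boundary) {x : ℝ} (hx : x ∈ Ioo 0 π) : 0 < mode b 0 x := by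
  refine mul_pos (Real.sqrt_pos.2 (by positivity)) (Real.sin_pos_of_pos_of_lt_pi ?_ ?_)
  · exact mul_pos (freq_succ_pos b 0) hx.1
  · have h1 : b.freq (0 + 1) ≤ 1 := by cases b <;> simp [Boundary.freq]
    nlinarith [hx.1, hx.2]

/-- By the recurrence, multiplication by `cos` preserves the span of the modes, so orthogonality to
all modes survives it. -/
theorem integral_mul_cos_pow_mul_mode {b : Boundary} {h : ℝ → ℂ}
    (hi : IntervalIntegrable h volume 0 π) (h0 : ∀ k, coef b h k = 0) (j k : ℕ) :
    ∫ x in (0 : ℝ)..π, h x * ((Real.cos x ^ j * mode b k x : ℝ) : ℂ) = 0 := by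
  have hint : ∀ g : ℝ → ℝ, Continuous g →
      IntervalIntegrable (fun x => h x * ((g x : ℝ) : ℂ)) volume 0 π := fun g hg =>
    hi.mul_continuousOn (Complex.continuous_ofReal.comp hg).continuousOn
  have hcont : ∀ j k, Continuous fun x => Real.cos x ^ j * mode b k x := fun j k =>
    (Real.continuous_cos.pow j).mul (continuous_mode b k)
  induction j generalizing k with
  | zero => simpa [coef] using h0 k
  | succ j ih =>
    cases k with
    | zero =>
      obtain ⟨c, hc⟩ := two_cos_mul_mode_zero b
      have e : ∀ x, h x * ((Real.cos x ^ (j + 1) * mode b 0 x : ℝ) : ℂ)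
          = (1 / 2) * (h x * ((Real.cos x ^ j * mode b 1 x : ℝ) : ℂ))
            + (c / 2) * (h x * ((Real.cos x ^ j * mode b 0 x : ℝ) : ℂ)) := fun x => by
        have := congrArg (fun r : ℝ => (r : ℂ)) (hc x)
        push_cast at this ⊢
        linear_combination (h x * Complex.cos x ^ j / 2) * this
      simp_rw [e]
      rw [intervalIntegral.integral_add ((hint _ (hcont j 1)).const_mul _)
        ((hint _ (hcont j 0)).const_mul _), intervalIntegral.integral_const_mul,
        intervalIntegral.integral_const_mul, ih, ih]
      simp
    | succ k =>
      have e : ∀ x, h x * ((Real.cos x ^ (j + 1) * mode b (k + 1) x : ℝ) : ℂ)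
          = (1 / 2) * (h x * ((Real.cos x ^ j * mode b (k + 2) x : ℝ) : ℂ))
            + (1 / 2) * (h x * ((Real.cos x ^ j * mode b k x : ℝ) : ℂ)) := fun x => by
        have := congrArg (fun r : ℝ => (r : ℂ)) (two_cos_mul_mode_succ b k x)
        push_cast at this ⊢
        linear_combination (h x * Complex.cos x ^ j / 2) * this
      simp_rw [e]
      rw [intervalIntegral.integral_add ((hint _ (hcont j (k + 2))).const_mul _)
        ((hint _ (hcont j k)).const_mul _), intervalIntegral.integral_const_mul,
        intervalIntegral.integral_const_mul, ih, ih]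
      simp

theorem integral_mul_mode_zero_mul_eq_zero {b : Boundary} {h : ℝ → ℂ}
    (hi : IntervalIntegrable h volume 0 π) (h0 : ∀ k, coef b h k = 0) {φ : ℝ → ℝ}
    (hφ : ContinuousOn φ (Icc 0 π)) :
    ∫ x in (0 : ℝ)..π, h x * mode b 0 x * (φ x : ℂ) = 0 := by
  set G : ℝ → ℂ := fun x => h x * mode b 0 x with hG
  have hGi : IntervalIntegrable G volume 0 π :=
    hi.mul_continuousOn (continuous_mode_complex b 0).continuousOn
  have hpoly : ∀ p : Polynomial ℝ, ∫ x in (0 : ℝ)..π, G x * ((p.eval (Real.cos x) : ℝ) : ℂ) = 0 := by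
    intro p
    have e : ∀ x, G x * ((p.eval (Real.cos x) : ℝ) : ℂ)
        = ∑ i ∈ Finset.range (p.natDegree + 1),
          (p.coeff i : ℂ) * (h x * ((Real.cos x ^ i * mode b 0 x : ℝ) : ℂ)) := fun x => by
      rw [Polynomial.eval_eq_sum_range]
      push_cast
      rw [Finset.mul_sum]
      exact Finset.sum_congr rfl fun i _ => by simp only [hG]; ring
    simp_rw [e]
    rw [intervalIntegral.integral_finsetSum]
    · refine Finset.sum_eq_zero fun i _ => ?_
      rw [intervalIntegral.integral_const_mul, integral_mul_cos_pow_mul_mode hi h0, mul_zero]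
    · intro i _
      exact (hi.mul_continuousOn (Complex.continuous_ofReal.comp
        ((Real.continuous_cos.pow i).mul (continuous_mode b 0))).continuousOn).const_mul _
  -- With `t = cos x`, Weierstrass approximation on `[-1, 1]` makes polynomials in `cos` uniformly
  -- dense in the continuous functions on `[0, π]`.
  have hφc : ContinuousOn (fun t => φ (Real.arccos t)) (Icc (-1) 1) :=
    hφ.comp Real.continuous_arccos.continuousOn fun t _ =>
      ⟨Real.arccos_nonneg t, Real.arccos_le_pi t⟩
  have hφC : ContinuousOn (fun x => (φ x : ℂ)) (uIcc 0 π) := by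
    rw [uIcc_of_le Real.pi_pos.le]
    exact Complex.continuous_ofReal.comp_continuousOn hφ
  set K := ∫ x in (0 : ℝ)..π, ‖G x‖ with hK
  have hK0 : 0 ≤ K := intervalIntegral.integral_nonneg Real.pi_pos.le fun _ _ => norm_nonneg _
  refine norm_le_zero_iff.1 (le_of_forall_pos_le_add fun ε hε => ?_)
  obtain ⟨p, hp⟩ := exists_polynomial_near_of_continuousOn (-1) 1 _ hφc (ε / (K + 1))
    (by positivity)
  have hpi : IntervalIntegrable (fun x => G x * ((p.eval (Real.cos x) : ℝ) : ℂ)) volume 0 π :=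
    hGi.mul_continuousOn (Complex.continuous_ofReal.comp
      (p.continuous.comp Real.continuous_cos)).continuousOn
  have hsub : ∫ x in (0 : ℝ)..π, G x * (φ x : ℂ)
      = ∫ x in (0 : ℝ)..π, (G x * (φ x : ℂ) - G x * ((p.eval (Real.cos x) : ℝ) : ℂ)) := by
    rw [intervalIntegral.integral_sub (hGi.mul_continuousOn hφC) hpi, hpoly, sub_zero]
  rw [hsub, zero_add]
  calc _ ≤ ∫ x in (0 : ℝ)..π, ε / (K + 1) * ‖G x‖ := by
        refine intervalIntegral.norm_integral_le_of_norm_le Real.pi_pos.le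
          (Filter.Eventually.of_forall fun x hx => ?_) (hGi.norm.const_mul _)
        have h1 := hp (Real.cos x) ⟨Real.neg_one_le_cos x, Real.cos_le_one x⟩
        rw [Real.arccos_cos hx.1.le hx.2] at h1
        rw [← mul_sub, norm_mul, mul_comm, ← Complex.ofReal_sub, Complex.norm_real,
          Real.norm_eq_abs, abs_sub_comm]
        gcongr
    _ = ε * (K / (K + 1)) := by rw [intervalIntegral.integral_const_mul]; ring
    _ ≤ ε := mul_le_of_le_one_right hε.le (div_le_one_of_le₀ (by linarith) (by linarith))

/-- Testing `h` times the first mode against the conjugate of `h` gives `∫ ‖h‖² mode 0 = 0`. The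
first mode is positive on `(0, π)`, so `h` vanishes there, and at the end points by continuity. -/
theorem eqOn_zero_of_coef_eq_zero {b : Boundary} {h : ℝ → ℂ} (hc : ContinuousOn h (Icc 0 π))
    (h0 : ∀ k, coef b h k = 0) : EqOn h 0 (Icc 0 π) := by
  have huI : uIcc (0 : ℝ) π = Icc 0 π := uIcc_of_le Real.pi_pos.le
  have hi : IntervalIntegrable h volume 0 π := (huI ▸ hc).intervalIntegrable
  have hre : ContinuousOn (fun x => (h x).re) (Icc 0 π) := Complex.continuous_re.comp_continuousOn hc
  have him : ContinuousOn (fun x => (h x).im) (Icc 0 π) := Complex.continuous_im.comp_continuousOn hc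
  have hofReal : ∀ {φ : ℝ → ℝ}, ContinuousOn φ (Icc 0 π) →
      ContinuousOn (fun x => (φ x : ℂ)) (uIcc 0 π) := fun hφ => by
    rw [huI]; exact Complex.continuous_ofReal.comp_continuousOn hφ
  have hGi : IntervalIntegrable (fun x => h x * mode b 0 x) volume 0 π :=
    hi.mul_continuousOn (continuous_mode_complex b 0).continuousOn
  have hz : ∫ x in (0 : ℝ)..π, ‖h x‖ ^ 2 * mode b 0 x = 0 := by
    have e : ∀ x, ((‖h x‖ ^ 2 * mode b 0 x : ℝ) : ℂ)
        = h x * mode b 0 x * ((h x).re : ℂ)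
          - Complex.I * (h x * mode b 0 x * ((h x).im : ℂ)) := fun x => by
      have : (h x).re - Complex.I * (h x).im = (starRingEnd ℂ) (h x) := by
        apply Complex.ext <;> simp
      have h2 := Complex.mul_conj (h x)
      rw [Complex.normSq_eq_norm_sq] at h2
      push_cast at h2 ⊢
      rw [← h2, ← this]
      ring
    have : ((∫ x in (0 : ℝ)..π, ‖h x‖ ^ 2 * mode b 0 x : ℝ) : ℂ) = 0 := by
      rw [← intervalIntegral.integral_ofReal]
      simp_rw [e]
      rw [intervalIntegral.integral_sub (hGi.mul_continuousOn (hofReal hre))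
        ((hGi.mul_continuousOn (hofReal him)).const_mul _), intervalIntegral.integral_const_mul,
        integral_mul_mode_zero_mul_eq_zero hi h0 hre, integral_mul_mode_zero_mul_eq_zero hi h0 him]
      simp
    exact_mod_cast this
  have hIoo : ∀ x ∈ Ioo 0 π, h x = 0 := by
    intro x hx
    by_contra hne
    have hcont : ContinuousOn (fun x => ‖h x‖ ^ 2 * mode b 0 x) (Icc 0 π) :=
      (hc.norm.pow 2).mul (continuous_mode b 0).continuousOn
    have hnn : ∀ x ∈ Ioc 0 π, 0 ≤ ‖h x‖ ^ 2 * mode b 0 x := by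
      intro y hy
      rcases hy.2.eq_or_lt with rfl | hlt
      · refine mul_nonneg (by positivity) (mul_nonneg (Real.sqrt_nonneg _)
          (Real.sin_nonneg_of_nonneg_of_le_pi ?_ ?_))
        · exact mul_nonneg (freq_succ_pos b 0).le Real.pi_pos.le
        · have h1 : b.freq (0 + 1) ≤ 1 := by cases b <;> simp [Boundary.freq]
          nlinarith [Real.pi_pos]
      · exact mul_nonneg (by positivity) (mode_zero_pos b ⟨hy.1, hlt⟩).le
    have := intervalIntegral.integral_pos Real.pi_pos hcont hnn
      ⟨x, Ioo_subset_Icc_self hx, mul_pos (by positivity) (mode_zero_pos b hx)⟩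
    linarith
  have hcl : closure (Ioo (0 : ℝ) π) = Icc 0 π := closure_Ioo Real.pi_pos.ne
  intro x hx
  have hx' : x ∈ closure (Ioo (0 : ℝ) π) := hcl ▸ hx
  have hmem : (nhdsWithin x (Ioo (0 : ℝ) π)).NeBot := mem_closure_iff_nhdsWithin_neBot.1 hx'
  have h1 : Filter.Tendsto h (nhdsWithin x (Ioo (0 : ℝ) π)) (nhds (h x)) :=
    (hc x hx).mono_left (nhdsWithin_mono x Ioo_subset_Icc_self)
  have h2 : Filter.Tendsto h (nhdsWithin x (Ioo (0 : ℝ) π)) (nhds 0) :=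
    tendsto_const_nhds.congr' (by
      filter_upwards [self_mem_nhdsWithin] with y hy
      exact (hIoo y hy).symm)
  exact tendsto_nhds_unique h1 h2

theorem eqOn_of_coef_eq {b : Boundary} {f g : ℝ → ℂ} (hf : ContinuousOn f (Icc 0 π))
    (hg : ContinuousOn g (Icc 0 π)) (h : ∀ k, coef b f k = coef b g k) : EqOn f g (Icc 0 π) := by
  have huI : uIcc (0 : ℝ) π = Icc 0 π := uIcc_of_le Real.pi_pos.le
  have key : ∀ k, coef b (fun x => f x - g x) k = 0 := fun k => by
    have e : ∀ x, (f x - g x) * (mode b k x : ℂ) = f x * mode b k x - g x * mode b k x :=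
      fun x => by ring
    unfold coef
    simp_rw [e]
    rw [intervalIntegral.integral_sub
      ((huI ▸ hf).intervalIntegrable.mul_continuousOn (continuous_mode_complex b k).continuousOn)
      ((huI ▸ hg).intervalIntegrable.mul_continuousOn (continuous_mode_complex b k).continuousOn)]
    exact sub_eq_zero.2 (h k)
  exact fun x hx => sub_eq_zero.1 (eqOn_zero_of_coef_eq_zero (hf.sub hg) key hx)

/-- The sum of the generalized Fourier series with coefficients `u`. -/
noncomputable def synth (b : Boundary) (u : ℕ → ℂ) (x : ℝ) : ℂ := ∑' k, u k * mode b k x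

variable {b : Boundary} {u : ℕ → ℂ}

theorem norm_synth_term_le (b : Boundary) (u : ℕ → ℂ) (k : ℕ) (x : ℝ) :
    ‖u k * (mode b k x : ℂ)‖ ≤ √(2 / π) * ‖u k‖ := by
  rw [norm_mul, mul_comm]
  exact mul_le_mul_of_nonneg_right (norm_mode_le b k x) (norm_nonneg _)

theorem summable_synth (hu : Summable fun k => ‖u k‖) (x : ℝ) :
    Summable fun k => u k * (mode b k x : ℂ) :=
  Summable.of_norm_bounded (hu.mul_left _) fun k => norm_synth_term_le b u k x

theorem norm_synth_le (hu : Summable fun k => ‖u k‖) (x : ℝ) :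
    ‖synth b u x‖ ≤ √(2 / π) * ∑' k, ‖u k‖ := by
  rw [← tsum_mul_left]
  exact tsum_of_norm_bounded (hu.mul_left _).hasSum fun k => norm_synth_term_le b u k x

theorem continuous_synth (hu : Summable fun k => ‖u k‖) : Continuous (synth b u) :=
  continuous_tsum (fun k => continuous_const.mul (continuous_mode_complex b k)) (hu.mul_left _)
    fun k x => norm_synth_term_le b u k x

/-- The modes are uniformly bounded, so summability of `u` suffices to integrate term by term
against any integrable `g`. -/
theorem hasSum_integral_mul_synth (hu : Summable fun k => ‖u k‖) {g : ℝ → ℂ}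
    (hg : IntervalIntegrable g volume 0 π) :
    HasSum (fun k => (∫ x in (0 : ℝ)..π, g x * mode b k x) * u k)
      (∫ x in (0 : ℝ)..π, g x * synth b u x) := by
  have hgi : ∀ k, IntervalIntegrable (fun x => g x * (u k * mode b k x)) volume 0 π := fun k =>
    hg.mul_continuousOn (continuous_const.mul (continuous_mode_complex b k)).continuousOn
  have h := hasSum_integral_of_summable_integral_norm
    (μ := volume.restrict (Ioc (0 : ℝ) π)) (F := fun k x => g x * (u k * (mode b k x : ℂ)))
    (fun k => (hgi k).1) ?_
  · simp_rw [tsum_mul_left] at h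
    simp only [intervalIntegral.integral_of_le Real.pi_pos.le]
    have e : (fun k => (∫ x in Ioc (0 : ℝ) π, g x * (mode b k x : ℂ)) * u k)
        = fun k => ∫ x in Ioc (0 : ℝ) π, g x * (u k * (mode b k x : ℂ)) := funext fun k => by
      rw [← integral_mul_const]
      congr 1
      funext x
      ring
    rw [e]
    exact h
  · refine Summable.of_nonneg_of_le (fun k => integral_nonneg fun _ => norm_nonneg _)
      (fun k => ?_) (hu.mul_left ((∫ x in Ioc (0 : ℝ) π, ‖g x‖) * √(2 / π)))
    calc _ ≤ ∫ x in Ioc (0 : ℝ) π, ‖g x‖ * (√(2 / π) * ‖u k‖) := by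
          refine integral_mono (hgi k).1.norm (hg.1.norm.mul_const _) fun x => ?_
          simp only [norm_mul]
          rw [← norm_mul]
          exact mul_le_mul_of_nonneg_left (norm_synth_term_le b u k x) (norm_nonneg _)
      _ = _ := by rw [integral_mul_const]; ring

theorem coef_synth (hu : Summable fun k => ‖u k‖) (j : ℕ) : coef b (synth b u) j = u j := by
  have h := hasSum_integral_mul_synth (b := b) hu (g := fun x => (mode b j x : ℂ))
    ((continuous_mode_complex b j).intervalIntegrable _ _)
  have e : ∀ k, (∫ x in (0 : ℝ)..π, (mode b j x : ℂ) * mode b k x) * u k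
      = if k = j then u j else 0 := fun k => by
    have := coef_mode b j k
    unfold coef at this
    rw [this]
    by_cases hjk : j = k
    · simp [hjk]
    · rw [if_neg hjk, if_neg (Ne.symm hjk), zero_mul]
  simp_rw [e] at h
  rw [← (hasSum_ite_eq j (u j)).unique h |>.symm]
  exact intervalIntegral.integral_congr fun x _ => mul_comm _ _

end Modes

theorem uIcc_zero_pi : uIcc (0 : ℝ) π = Icc 0 π := uIcc_of_le Real.pi_pos.le

/-! ### Fundamental theorem of calculus for complex absolutely continuous functions -/

section AbsolutelyContinuous

theorem absolutelyContinuous_primitive {f : ℝ → ℂ} (hf : IntervalIntegrable f volume 0 π) :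
    AbsolutelyContinuousOnInterval (fun x => ∫ t in (0 : ℝ)..x, f t) 0 π := by
  have hre : IntervalIntegrable (fun x => (f x).re) volume 0 π := ⟨hf.1.re, hf.2.re⟩
  have him : IntervalIntegrable (fun x => (f x).im) volume 0 π := ⟨hf.1.im, hf.2.im⟩
  have hconst : ∀ c : ℂ, AbsolutelyContinuousOnInterval (fun _ : ℝ => c) 0 π := fun c =>
    (contDiff_const.contDiffOn).absolutelyContinuousOnInterval
  have h := ((hre.absolutelyContinuousOnInterval_intervalIntegral (c := 0) (by simp)).smul
    (hconst 1)).add ((him.absolutelyContinuousOnInterval_intervalIntegral (c := 0) (by simp)).smul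
    (hconst Complex.I))
  refine absCont_congr (fun x hx => ?_) h
  have hsub : uIcc 0 x ⊆ uIcc 0 π := by
    rw [uIcc_zero_pi, uIcc_of_le hx.1]
    exact Icc_subset_Icc_right hx.2
  have hx1 := hre.mono_set hsub
  have hx2 := him.mono_set hsub
  simp only [Pi.add_apply, Pi.smul_apply', Complex.real_smul, mul_one]
  rw [← intervalIntegral.integral_ofReal, ← intervalIntegral.integral_ofReal,
    ← intervalIntegral.integral_mul_const, ← intervalIntegral.integral_add]
  · exact intervalIntegral.integral_congr fun t _ => Complex.re_add_im (f t)
  · exact ⟨hx1.1.ofReal, hx1.2.ofReal⟩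
  · exact IntervalIntegrable.mul_const ⟨hx2.1.ofReal, hx2.2.ofReal⟩ _

/-- Subtracting the primitive of `f'` leaves an absolutely continuous function with derivative zero
almost everywhere, hence a constant. -/
theorem integral_eq_sub_of_absolutelyContinuous {f f' : ℝ → ℂ}
    (hf : AbsolutelyContinuousOnInterval f 0 π)
    (hd : ∀ᵐ x, x ∈ Ioo 0 π → HasDerivAt f (f' x) x) (hi : IntervalIntegrable f' volume 0 π) :
    ∫ x in (0 : ℝ)..π, f' x = f π - f 0 := by
  have h0 : ∀ᵐ x : ℝ, x ≠ 0 := by simp [ae_iff, measure_singleton]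
  have hπ : ∀ᵐ x : ℝ, x ≠ π := by simp [ae_iff, measure_singleton]
  have hz : ∀ᵐ x, x ∈ uIcc 0 π →
      HasDerivAt (fun x => f x - ∫ t in (0 : ℝ)..x, f' t) 0 x := by
    filter_upwards [hd, hi.ae_hasDerivAt_integral, h0, hπ] with x h1 h2 h3 h4 h5
    have h6 := h5
    rw [uIcc_zero_pi] at h6
    have := (h1 ⟨lt_of_le_of_ne h6.1 h3.symm, lt_of_le_of_ne h6.2 h4⟩).sub (h2 h5 0 (by simp))
    rwa [sub_self] at this
  obtain ⟨C, hC⟩ := (hf.sub (absolutelyContinuous_primitive hi)).const_of_ae_hasDerivAt_zero hz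
  have e0 := hC 0 (by simp)
  have eπ := hC π (by simp)
  simp only [Pi.sub_apply, intervalIntegral.integral_same, sub_zero] at e0 eπ
  rw [e0, ← eπ]
  ring

end AbsolutelyContinuous

/-! ### Green's formula against a mode -/

section Green

theorem hasDerivAt_mode (b : Boundary) (k : ℕ) (x : ℝ) :
    HasDerivAt (fun x => (mode b k x : ℂ))
      ((√(2 / π) * (b.freq (k + 1) * Real.cos (b.freq (k + 1) * x)) : ℝ) : ℂ) x := by
  refine HasDerivAt.ofReal_comp ?_
  have h := (((hasDerivAt_id' x).const_mul (b.freq (k + 1))).sin).const_mul √(2 / π)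
  exact h.congr_deriv (by ring)

theorem hasDerivAt_modeDeriv (b : Boundary) (k : ℕ) (x : ℝ) :
    HasDerivAt (fun x => ((√(2 / π) * (b.freq (k + 1) * Real.cos (b.freq (k + 1) * x)) : ℝ) : ℂ))
      (-(b.freq (k + 1)) ^ 2 * (mode b k x : ℂ)) x := by
  have h := (((((hasDerivAt_id' x).const_mul (b.freq (k + 1))).cos).const_mul
    (b.freq (k + 1))).const_mul √(2 / π)).ofReal_comp
  exact h.congr_deriv (by unfold mode; push_cast; ring)

theorem mode_at_zero (b : Boundary) (k : ℕ) : mode b k 0 = 0 := by simp [mode]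

theorem mode_dirichlet_at_pi (k : ℕ) : mode .dirichlet k π = 0 := by
  simp only [mode, Boundary.freq, Real.sin_nat_mul_pi, mul_zero]

theorem cos_freq_dirichletNeumann_pi (k : ℕ) :
    Real.cos (Boundary.freq (k + 1) .dirichletNeumann * π) = 0 := by
  refine Real.cos_eq_zero_iff.2 ⟨k, ?_⟩
  simp only [Boundary.freq]
  push_cast
  ring

/-- Green's formula. -/
theorem coef_second_derivative {b : Boundary} {Y₀ Y₁ Y₂ : ℝ → ℂ}
    (hd : ∀ x ∈ Icc 0 π, HasDerivWithinAt Y₀ (Y₁ x) (Icc 0 π) x)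
    (hY₁ : AbsolutelyContinuousOnInterval Y₁ 0 π)
    (hd₁ : ∀ᵐ x, x ∈ Ioo 0 π → HasDerivAt Y₁ (Y₂ x) x)
    (hi : IntervalIntegrable Y₂ volume 0 π) (h0 : Y₀ 0 = 0)
    (hD : b = .dirichlet → Y₀ π = 0) (hN : b = .dirichletNeumann → Y₁ π = 0) (k : ℕ) :
    coef b Y₂ k = -(b.freq (k + 1) : ℂ) ^ 2 * coef b Y₀ k := by
  set s : ℝ → ℂ := fun x => (mode b k x : ℂ) with hs
  set s' : ℝ → ℂ := fun x =>
    ((√(2 / π) * (b.freq (k + 1) * Real.cos (b.freq (k + 1) * x)) : ℝ) : ℂ) with hs'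
  have hY₀c : ContinuousOn Y₀ (Icc 0 π) := fun x hx => (hd x hx).continuousWithinAt
  have hY₁c : ContinuousOn Y₁ (Icc 0 π) := uIcc_zero_pi ▸ hY₁.continuousOn
  have hY₀ : AbsolutelyContinuousOnInterval Y₀ 0 π := by
    obtain ⟨C, hC⟩ := isCompact_Icc.exists_bound_of_continuousOn hY₁c
    have hC' : ∀ x ∈ Icc 0 π, ‖Y₁ x‖₊ ≤ C.toNNReal := fun x hx =>
      (Real.le_toNNReal_iff_coe_le ((norm_nonneg _).trans (hC x hx))).2 (hC x hx)
    have := (convex_Icc (0 : ℝ) π).lipschitzOnWith_of_nnnorm_hasDerivWithin_le hd hC'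
    rw [← uIcc_zero_pi] at this
    exact this.absolutelyContinuousOnInterval
  have hsc : ContDiff ℝ 1 s := Complex.ofRealCLM.contDiff.comp
    (contDiff_const.mul (Real.contDiff_sin.comp (contDiff_const.mul contDiff_id)))
  have hsc' : ContDiff ℝ 1 s' := Complex.ofRealCLM.contDiff.comp
    (contDiff_const.mul (contDiff_const.mul (Real.contDiff_cos.comp
      (contDiff_const.mul contDiff_id))))
  -- The Wronskian of `Y₀` and the mode. Its boundary values vanish because each end point condition
  -- is shared by the mode.
  have hW : AbsolutelyContinuousOnInterval (fun x => Y₁ x * s x - Y₀ x * s' x) 0 π :=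
    (hY₁.smul hsc.contDiffOn.absolutelyContinuousOnInterval).sub
      (hY₀.smul hsc'.contDiffOn.absolutelyContinuousOnInterval)
  have hWd : ∀ᵐ x, x ∈ Ioo 0 π → HasDerivAt (fun x => Y₁ x * s x - Y₀ x * s' x)
      (Y₂ x * s x + (b.freq (k + 1) : ℂ) ^ 2 * (Y₀ x * s x)) x := by
    filter_upwards [hd₁] with x h1 hx
    have h2 := (hd x (Ioo_subset_Icc_self hx)).hasDerivAt (Icc_mem_nhds hx.1 hx.2)
    have h3 := ((h1 hx).mul (hasDerivAt_mode b k x)).sub (h2.mul (hasDerivAt_modeDeriv b k x))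
    exact h3.congr_deriv (by simp only [hs]; ring)
  have hYs : IntervalIntegrable (fun x => Y₀ x * s x) volume 0 π := by
    refine ContinuousOn.intervalIntegrable ?_
    rw [uIcc_zero_pi]
    exact hY₀c.mul hsc.continuous.continuousOn
  have hYs2 : IntervalIntegrable (fun x => Y₂ x * s x) volume 0 π :=
    hi.mul_continuousOn hsc.continuous.continuousOn
  have h := integral_eq_sub_of_absolutelyContinuous hW hWd (hYs2.add (hYs.const_mul _))
  rw [intervalIntegral.integral_add hYs2 (hYs.const_mul _),
    intervalIntegral.integral_const_mul] at h
  have hs0 : s 0 = 0 := by simp [hs, mode_at_zero]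
  have hbd : Y₁ π * s π - Y₀ π * s' π = 0 := by
    cases b
    · rw [hD rfl]; simp [hs, mode_dirichlet_at_pi]
    · rw [hN rfl]; simp only [hs', cos_freq_dirichletNeumann_pi]; simp
  rw [hbd, hs0, h0] at h
  unfold coef
  linear_combination h

end Green

/-! ### Coefficients of the differential operator; the problem without potential -/

section Regularity

theorem hasDerivWithinAt_D {y : ℝ → ℂ} {n k : ℕ}
    (hy : ContDiffOn ℝ (n : WithTop ℕ∞) y (Icc 0 π)) (hk : k < n) {x : ℝ} (hx : x ∈ Icc 0 π) :
    HasDerivWithinAt (D k y) (D (k + 1) y x) (Icc 0 π) x := by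
  have h := (hy.differentiableOn_iteratedDerivWithin (m := k) (by exact_mod_cast hk)
    (uniqueDiffOn_Icc Real.pi_pos)) x hx
  have := h.hasDerivWithinAt
  rwa [← iteratedDerivWithin_succ] at this

theorem continuousOn_D {y : ℝ → ℂ} {n k : ℕ}
    (hy : ContDiffOn ℝ (n : WithTop ℕ∞) y (Icc 0 π)) (hk : k ≤ n) :
    ContinuousOn (D k y) (Icc 0 π) :=
  hy.continuousOn_iteratedDerivWithin (by exact_mod_cast hk) (uniqueDiffOn_Icc Real.pi_pos)

theorem D_zero (y : ℝ → ℂ) : D 0 y = y := by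
  funext x; simp [D]

theorem D_congr {y w : ℝ → ℂ} (h : EqOn y w (Icc 0 π)) (k : ℕ) : EqOn (D k y) (D k w) (Icc 0 π) :=
  iteratedDerivWithin_congr h

theorem eqOn_derivWithin {Y₀ Y₁ : ℝ → ℂ}
    (hd : ∀ x ∈ Icc 0 π, HasDerivWithinAt Y₀ (Y₁ x) (Icc 0 π) x) :
    EqOn (derivWithin Y₀ (Icc 0 π)) Y₁ (Icc 0 π) := fun x hx =>
  (hd x hx).derivWithin (uniqueDiffOn_Icc Real.pi_pos x hx)

theorem D_succ_of_hasDerivWithinAt {Y₀ Y₁ : ℝ → ℂ}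
    (hd : ∀ x ∈ Icc 0 π, HasDerivWithinAt Y₀ (Y₁ x) (Icc 0 π) x) (k : ℕ) :
    EqOn (D (k + 1) Y₀) (D k Y₁) (Icc 0 π) := by
  intro x hx
  unfold D
  rw [iteratedDerivWithin_succ']
  exact D_congr (eqOn_derivWithin hd) k hx

theorem contDiffOn_succ_of_hasDerivWithinAt {Y₀ Y₁ : ℝ → ℂ} {n : ℕ}
    (hd : ∀ x ∈ Icc 0 π, HasDerivWithinAt Y₀ (Y₁ x) (Icc 0 π) x)
    (hY₁ : ContDiffOn ℝ (n : WithTop ℕ∞) Y₁ (Icc 0 π)) :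
    ContDiffOn ℝ ((n + 1 : ℕ) : WithTop ℕ∞) Y₀ (Icc 0 π) := by
  rw [Nat.cast_succ, contDiffOn_succ_iff_derivWithin (uniqueDiffOn_Icc Real.pi_pos)]
  exact ⟨fun x hx => (hd x hx).differentiableWithinAt, fun h => by simp at h,
    hY₁.congr (eqOn_derivWithin hd)⟩

theorem Maps.congr {b : Boundary} {m : ℕ} {q y g y' g' : ℝ → ℂ} (h : Maps b m q y g)
    (hy : EqOn y y' (Icc 0 π)) (hg : EqOn g g' (Icc 0 π)) : Maps b m q y' g' where
  contDiffOn := h.contDiffOn.congr hy.symm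
  absCont := absCont_congr (D_congr hy _) h.absCont
  boundary := by
    have h0 : (0 : ℝ) ∈ Icc 0 π := ⟨le_rfl, Real.pi_pos.le⟩
    have hπ : π ∈ Icc 0 π := ⟨Real.pi_pos.le, le_rfl⟩
    have A := h.boundary
    cases b <;>
    · intro i hi
      exact ⟨(D_congr hy _ h0).symm.trans (A i hi).1, (D_congr hy _ hπ).symm.trans (A i hi).2⟩
  equation := by
    filter_upwards [h.equation, ae_restrict_mem measurableSet_Ioo] with x ⟨d, hd, e⟩ hx
    have hx' := Ioo_subset_Icc_self hx
    exact ⟨d, hd.congr (D_congr hy.symm _) (D_congr hy.symm _ hx'), by rw [← hy hx', ← hg hx', e]⟩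

/-- Green's formula `m` times: each application produces `-freq²`, and the sign `(-1) ^ m` cancels.
Only the last one meets a derivative that exists merely almost everywhere. -/
theorem coef_of_maps {b : Boundary} {m : ℕ} (hm : 1 ≤ m) {q y g : ℝ → ℂ} (h : Maps b m q y g)
    (hi : IntervalIntegrable (fun x => g x - q x * y x) volume 0 π) (k : ℕ) :
    freeEigenvalue b m k * coef b y k = coef b (fun x => g x - q x * y x) k := by
  have hB0 : ∀ i < m, D (2 * i) y 0 = 0 := by
    have := h.boundary
    cases b <;> exact fun i hi => (this i hi).1
  have hBD : b = .dirichlet → ∀ i < m, D (2 * i) y π = 0 := by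
    rintro rfl i hi
    exact (h.boundary i hi).2
  have hBN : b = .dirichletNeumann → ∀ i < m, D (2 * i + 1) y π = 0 := by
    rintro rfl i hi
    exact (h.boundary i hi).2
  have hsmooth : ∀ i < m, coef b (D (2 * i) y) k
      = (-(b.freq (k + 1) : ℂ) ^ 2) ^ i * coef b y k := by
    intro i
    induction i with
    | zero => intro _; simp [D_zero]
    | succ i ih =>
      intro him
      have hc := h.contDiffOn
      have hc2 : ContinuousOn (D (2 * i + 2) y) (Icc 0 π) := continuousOn_D hc (by omega)
      have hD1 : ∀ x ∈ Icc 0 π, HasDerivWithinAt (D (2 * i + 1) y) (D (2 * i + 2) y x)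
          (Icc 0 π) x := fun x hx => hasDerivWithinAt_D hc (by omega) hx
      have hac : AbsolutelyContinuousOnInterval (D (2 * i + 1) y) 0 π := by
        refine ContDiffOn.absolutelyContinuousOnInterval ?_
        rw [uIcc_zero_pi]
        have := contDiffOn_succ_of_hasDerivWithinAt (n := 0) hD1 (by
          simpa using (contDiffOn_zero (𝕜 := ℝ)).2 hc2)
        simpa using this
      have := coef_second_derivative (b := b)
        (fun x hx => hasDerivWithinAt_D hc (show 2 * i < 2 * m - 1 by omega) hx) hac
        (Filter.Eventually.of_forall fun x hx =>
          (hD1 x (Ioo_subset_Icc_self hx)).hasDerivAt (Icc_mem_nhds hx.1 hx.2))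
        (by rw [← uIcc_zero_pi] at hc2; exact hc2.intervalIntegrable)
        (hB0 i (by omega)) (fun hb => hBD hb i (by omega)) (fun hb => hBN hb i (by omega)) k
      rw [show 2 * (i + 1) = 2 * i + 2 by ring, this, ih (by omega)]
      ring
  obtain ⟨p, rfl⟩ : ∃ p, m = p + 1 := ⟨m - 1, by omega⟩
  have hidx : 2 * (p + 1) - 1 = 2 * p + 1 := by omega
  have hc := h.contDiffOn
  have hac := h.absCont
  have heq := h.equation
  rw [hidx] at hc hac heq
  have hae : ∀ᵐ x, x ∈ Ioo 0 π →
      HasDerivAt (D (2 * p + 1) y) ((-1) ^ (p + 1) * (g x - q x * y x)) x := by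
    filter_upwards [(ae_restrict_iff' measurableSet_Ioo).1 heq] with x hx hxm
    obtain ⟨d, hd, e⟩ := hx hxm
    have hd' := hd.hasDerivAt (Icc_mem_nhds hxm.1 hxm.2)
    refine hd'.congr_deriv ?_
    rw [← e, add_sub_cancel_right, ← mul_assoc, ← mul_pow]
    simp
  have := coef_second_derivative (b := b)
    (fun x hx => hasDerivWithinAt_D hc (show 2 * p < 2 * p + 1 by omega) hx) hac hae
    (hi.const_mul _) (hB0 p (by omega)) (fun hb => hBD hb p (by omega))
    (fun hb => hBN hb p (by omega)) k
  rw [hsmooth p (by omega)] at this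
  have e : coef b (fun x => (-1) ^ (p + 1) * (g x - q x * y x)) k
      = (-1) ^ (p + 1) * coef b (fun x => g x - q x * y x) k := by
    unfold coef
    simp_rw [mul_assoc]
    exact intervalIntegral.integral_const_mul _ _
  rw [e] at this
  have h1 : ((-1 : ℂ) ^ (p + 1)) * (-1) ^ (p + 1) = 1 := by rw [← mul_pow]; simp
  calc (freeEigenvalue b (p + 1) k : ℂ) * coef b y k
      = (-1) ^ (p + 1) * (-(b.freq (k + 1) : ℂ) ^ 2 *
          ((-(b.freq (k + 1) : ℂ) ^ 2) ^ p * coef b y k)) := by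
        unfold freeEigenvalue
        push_cast
        rw [← mul_assoc (-(b.freq (k + 1) : ℂ) ^ 2), ← pow_succ', neg_pow, pow_mul]
        linear_combination (-((b.freq (k + 1) : ℂ) ^ 2) ^ (p + 1) * coef b y k) * h1
    _ = _ := by
        rw [← this, ← mul_assoc, h1, one_mul]

theorem exists_second_order (b : Boundary) {f : ℝ → ℂ}
    (hf : ∀ a c, IntervalIntegrable f volume a c) :
    ∃ (c : ℂ) (Y : ℝ → ℂ), (∀ x, HasDerivAt Y (c - ∫ t in (0 : ℝ)..x, f t) x) ∧ Y 0 = 0 ∧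
      (b = .dirichlet → Y π = 0) ∧
      (b = .dirichletNeumann → c - ∫ t in (0 : ℝ)..π, f t = 0) := by
  have hcont : Continuous fun x => ∫ t in (0 : ℝ)..x, f t :=
    intervalIntegral.continuous_primitive hf 0
  have key : ∀ (c : ℂ) x, HasDerivAt
      (fun x : ℝ => c * (x : ℂ) - ∫ s in (0 : ℝ)..x, ∫ t in (0 : ℝ)..s, f t)
      (c - ∫ t in (0 : ℝ)..x, f t) x := fun c x => by
    have h1 := (HasDerivAt.ofReal_comp (hasDerivAt_id x)).const_mul c
    have h2 := intervalIntegral.integral_hasDerivAt_right (hcont.intervalIntegrable 0 x)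
      hcont.aestronglyMeasurable.stronglyMeasurableAtFilter hcont.continuousAt
    exact (h1.sub h2).congr_deriv (by simp)
  cases b
  · refine ⟨(π : ℂ)⁻¹ * ∫ s in (0 : ℝ)..π, ∫ t in (0 : ℝ)..s, f t, _, key _, by simp,
      fun _ => ?_, by simp⟩
    have : (π : ℂ) ≠ 0 := by exact_mod_cast Real.pi_ne_zero
    field_simp
    ring
  · exact ⟨∫ t in (0 : ℝ)..π, f t, _, key _, by simp, by simp, fun _ => sub_self _⟩

/-- The problem factors into `m` problems `-Y'' = y` with the same end conditions. If `y` solves the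
problem of order `2m`, the new conditions on `Y` hold by the choice of the integration constants,
and the others come from `y` because derivatives of `Y` of order `k + 2` are minus those of `y` of
order `k`. -/
theorem exists_maps_zero_potential (b : Boundary) {m : ℕ} (hm : 1 ≤ m) {f : ℝ → ℂ}
    (hf : IntervalIntegrable f volume 0 π) : ∃ y, Maps b m 0 y f := by
  have h0 : (0 : ℝ) ∈ Icc 0 π := ⟨le_rfl, Real.pi_pos.le⟩
  have hπ : π ∈ Icc 0 π := ⟨Real.pi_pos.le, le_rfl⟩
  induction m, hm using Nat.le_induction with
  | base =>
    -- The cut-off makes the right-hand side integrable on every interval, as `exists_second_order`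
    -- requires.
    set f₁ : ℝ → ℂ := indicator (Ioc 0 π) f with hf₁
    have hf₁i : Integrable f₁ := hf.1.integrable_indicator measurableSet_Ioc
    obtain ⟨c, Y, hY, hY0, hYD, hYN⟩ := exists_second_order b (f := f₁)
      fun _ _ => hf₁i.intervalIntegrable
    set Y₁ : ℝ → ℂ := fun x => c - ∫ t in (0 : ℝ)..x, f₁ t with hY₁
    have hd : ∀ x ∈ Icc 0 π, HasDerivWithinAt Y (Y₁ x) (Icc 0 π) x := fun x _ =>
      (hY x).hasDerivWithinAt
    have hY₁c : Continuous Y₁ := continuous_const.sub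
      (intervalIntegral.continuous_primitive (fun _ _ => hf₁i.intervalIntegrable) 0)
    have hD1 : EqOn (D 1 Y) Y₁ (Icc 0 π) := fun x hx => by
      rw [D_succ_of_hasDerivWithinAt hd 0 hx, D_zero]
    have hac : AbsolutelyContinuousOnInterval Y₁ 0 π :=
      (contDiff_const.contDiffOn.absolutelyContinuousOnInterval).sub
        (absolutelyContinuous_primitive hf₁i.intervalIntegrable)
    refine ⟨Y, ?_, ?_, ?_, ?_⟩
    · exact contDiffOn_succ_of_hasDerivWithinAt (n := 0) hd
        (by simpa using (contDiffOn_zero (𝕜 := ℝ)).2 hY₁c.continuousOn)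
    · exact absCont_congr hD1.symm hac
    · cases b <;> intro i hi <;> obtain rfl : i = 0 := by omega
      · simp only [mul_zero, D_zero]
        exact ⟨hY0, hYD rfl⟩
      · simp only [mul_zero, D_zero, zero_add]
        exact ⟨hY0, by rw [hD1 hπ]; exact hYN rfl⟩
    · have hae := (hf₁i.intervalIntegrable (a := 0) (b := π)).ae_hasDerivAt_integral
      rw [ae_restrict_iff' measurableSet_Ioo]
      filter_upwards [hae] with x hx hxm
      have hx' := Ioo_subset_Icc_self hxm
      have h1 := (hx (uIcc_zero_pi ▸ hx') 0 (by simp)).const_sub c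
      have hfx : f₁ x = f x := indicator_of_mem (Ioo_subset_Ioc_self hxm) f
      exact ⟨-f₁ x, h1.hasDerivWithinAt.congr hD1 (hD1 hx'), by simp [hfx]⟩
  | succ m hm ih =>
    obtain ⟨y, hy⟩ := ih
    set f₁ : ℝ → ℂ := IccExtend Real.pi_pos.le ((Icc 0 π).domRestrict y) with hf₁
    have hyc : ContinuousOn y (Icc 0 π) := hy.contDiffOn.continuousOn
    have hf₁c : Continuous f₁ := hyc.domRestrict.Icc_extend'
    have hf₁y : EqOn f₁ y (Icc 0 π) := fun x hx => by
      rw [hf₁, IccExtend_of_mem _ _ hx]; rfl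
    obtain ⟨c, Y, hY, hY0, hYD, hYN⟩ := exists_second_order b (f := f₁)
      fun _ _ => hf₁c.intervalIntegrable _ _
    set Y₁ : ℝ → ℂ := fun x => c - ∫ t in (0 : ℝ)..x, f₁ t with hY₁
    have hd : ∀ x ∈ Icc 0 π, HasDerivWithinAt Y (Y₁ x) (Icc 0 π) x := fun x _ =>
      (hY x).hasDerivWithinAt
    have hd₁ : ∀ x ∈ Icc 0 π, HasDerivWithinAt Y₁ (((-1 : ℂ) • y) x) (Icc 0 π) x := fun x hx => by
      have h2 := intervalIntegral.integral_hasDerivAt_right (hf₁c.intervalIntegrable 0 x)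
        hf₁c.aestronglyMeasurable.stronglyMeasurableAtFilter hf₁c.continuousAt
      have h3 := (h2.const_sub c).hasDerivWithinAt (s := Icc 0 π)
      rw [hf₁y hx] at h3
      simpa using h3
    have hD1 : EqOn (D 1 Y) Y₁ (Icc 0 π) := fun x hx => by
      rw [D_succ_of_hasDerivWithinAt hd 0 hx, D_zero]
    have hD2 : ∀ k, EqOn (D (k + 2) Y) ((-1 : ℂ) • D k y) (Icc 0 π) := fun k x hx => by
      rw [D_succ_of_hasDerivWithinAt hd (k + 1) hx, D_succ_of_hasDerivWithinAt hd₁ k hx, D_smul]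
    have hidx : 2 * (m + 1) - 1 = 2 * m - 1 + 2 := by omega
    refine ⟨Y, ?_, ?_, ?_, ?_⟩
    · rw [hidx]
      exact contDiffOn_succ_of_hasDerivWithinAt hd
        (contDiffOn_succ_of_hasDerivWithinAt hd₁ (hy.contDiffOn.const_smul (-1 : ℂ)))
    · rw [hidx]
      exact absCont_congr (hD2 _).symm (hy.absCont.const_smul (-1 : ℂ))
    · have A := hy.boundary
      cases b <;> intro i hi <;> rcases i with _ | i
      · simp only [mul_zero, D_zero]
        exact ⟨hY0, hYD rfl⟩
      · rw [show 2 * (i + 1) = 2 * i + 2 by ring, hD2 _ h0, hD2 _ hπ]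
        simp [(A i (by omega)).1, (A i (by omega)).2]
      · simp only [mul_zero, D_zero, zero_add]
        exact ⟨hY0, by rw [hD1 hπ]; exact hYN rfl⟩
      · rw [show 2 * (i + 1) + 1 = 2 * i + 1 + 2 by ring, show 2 * (i + 1) = 2 * i + 2 by ring,
          hD2 _ h0, hD2 _ hπ]
        simp [(A i (by omega)).1, (A i (by omega)).2]
    · rw [hidx]
      filter_upwards [hy.equation, ae_restrict_mem measurableSet_Ioo] with x ⟨e, he, h⟩ hx
      refine ⟨-1 * e, (he.const_smul (-1 : ℂ)).congr (hD2 _) (hD2 _ (Ioo_subset_Icc_self hx)), ?_⟩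
      rw [← h, pow_succ]
      simp

end Regularity

/-! ### Equivalence of the boundary problem with the infinite matrix equation -/

section Correspondence

/-- The matrix of the potential. -/
noncomputable def potentialMatrix (b : Boundary) (q : ℝ → ℂ) (j k : ℕ) : ℂ :=
  coef b (fun x => q x * mode b j x) k

variable {b : Boundary} {m : ℕ} {q : ℝ → ℂ}

theorem coef_mul_synth (hq : IntervalIntegrable q volume 0 π) {u : ℕ → ℂ}
    (hu : Summable fun k => ‖u k‖) (j : ℕ) :
    coef b (fun x => q x * synth b u x) j = ∑' k, potentialMatrix b q j k * u k := by
  have h := hasSum_integral_mul_synth (b := b) hu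
    (hq.mul_continuousOn (continuous_mode_complex b j).continuousOn)
  unfold potentialMatrix coef
  rw [h.tsum_eq]
  exact intervalIntegral.integral_congr fun x _ => by ring

theorem norm_potentialMatrix_le (hq : IntervalIntegrable q volume 0 π) (j k : ℕ) :
    ‖potentialMatrix b q j k‖ ≤ (2 / π) * ∫ x in (0 : ℝ)..π, ‖q x‖ := by
  unfold potentialMatrix coef
  rw [← intervalIntegral.integral_const_mul]
  refine intervalIntegral.norm_integral_le_of_norm_le Real.pi_pos.le
    (Filter.Eventually.of_forall fun x _ => ?_) (hq.norm.const_mul _)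
  have h2 : √(2 / π) * √(2 / π) = 2 / π := Real.mul_self_sqrt (by positivity)
  rw [← h2, norm_mul, norm_mul]
  calc _ ≤ ‖q x‖ * √(2 / π) * √(2 / π) := by
        gcongr
        exacts [norm_mode_le b j x, norm_mode_le b k x]
    _ = _ := by ring

theorem intervalIntegrable_sub_mul (hq : IntervalIntegrable q volume 0 π) {y g : ℝ → ℂ}
    (hy : ContinuousOn y (Icc 0 π)) (hg : ContinuousOn g (Icc 0 π)) :
    IntervalIntegrable (fun x => g x - q x * y x) volume 0 π := by
  rw [← uIcc_zero_pi] at hy hg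
  exact hg.intervalIntegrable.sub (hq.mul_continuousOn hy)

theorem coef_sub_mul (hq : IntervalIntegrable q volume 0 π) {y g : ℝ → ℂ}
    (hy : ContinuousOn y (Icc 0 π)) (hg : ContinuousOn g (Icc 0 π)) (k : ℕ) :
    coef b (fun x => g x - q x * y x) k = coef b g k - coef b (fun x => q x * y x) k := by
  rw [← uIcc_zero_pi] at hy hg
  have hs := (continuous_mode_complex b k).continuousOn (s := uIcc 0 π)
  unfold coef
  rw [← intervalIntegral.integral_sub (hg.intervalIntegrable.mul_continuousOn hs)
    ((hq.mul_continuousOn hy).mul_continuousOn hs)]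
  exact intervalIntegral.integral_congr fun x _ => by ring

theorem norm_coef_le {f : ℝ → ℂ} (hf : IntervalIntegrable f volume 0 π) (k : ℕ) :
    ‖coef b f k‖ ≤ √(2 / π) * ∫ x in (0 : ℝ)..π, ‖f x‖ := by
  unfold coef
  rw [← intervalIntegral.integral_const_mul]
  refine intervalIntegral.norm_integral_le_of_norm_le Real.pi_pos.le
    (Filter.Eventually.of_forall fun x _ => ?_) (hf.norm.const_mul _)
  rw [norm_mul, mul_comm]
  exact mul_le_mul_of_nonneg_right (norm_mode_le b k x) (norm_nonneg _)

theorem summable_coef_of_maps (hm : 1 ≤ m) (hq : IntervalIntegrable q volume 0 π) {y g : ℝ → ℂ}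
    (hg : ContinuousOn g (Icc 0 π)) (h : Maps b m q y g) : Summable fun k => ‖coef b y k‖ := by
  have hi := intervalIntegrable_sub_mul hq h.contDiffOn.continuousOn hg
  refine Summable.of_nonneg_of_le (fun _ => norm_nonneg _) (fun k => ?_)
    ((summable_inv_freeEigenvalue b hm).mul_right
      (√(2 / π) * ∫ x in (0 : ℝ)..π, ‖g x - q x * y x‖))
  have hpos := freeEigenvalue_pos b m k
  have e := congrArg norm (coef_of_maps hm h hi k)
  rw [norm_mul, Complex.norm_real, Real.norm_of_nonneg hpos.le] at e
  rw [inv_mul_eq_div, le_div_iff₀ hpos, mul_comm, e]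
  exact norm_coef_le hi k

theorem eqOn_synth_of_maps (hm : 1 ≤ m) (hq : IntervalIntegrable q volume 0 π) {y g : ℝ → ℂ}
    (hg : ContinuousOn g (Icc 0 π)) (h : Maps b m q y g) :
    EqOn y (synth b (coef b y)) (Icc 0 π) := by
  have hs := summable_coef_of_maps hm hq hg h
  exact eqOn_of_coef_eq h.contDiffOn.continuousOn (continuous_synth hs).continuousOn
    fun k => (coef_synth hs k).symm

theorem coef_congr {f g : ℝ → ℂ} (h : EqOn f g (Icc 0 π)) (k : ℕ) : coef b f k = coef b g k :=
  intervalIntegral.integral_congr fun x hx => by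
    rw [uIcc_zero_pi] at hx
    simp only [h hx]

theorem coef_equation_of_maps (hm : 1 ≤ m) (hq : IntervalIntegrable q volume 0 π) {y g : ℝ → ℂ}
    (hg : ContinuousOn g (Icc 0 π)) (h : Maps b m q y g) (j : ℕ) :
    freeEigenvalue b m j * coef b y j + ∑' k, potentialMatrix b q j k * coef b y k
      = coef b g j := by
  have hyc := h.contDiffOn.continuousOn
  have hE := eqOn_synth_of_maps hm hq hg h
  rw [coef_of_maps hm h (intervalIntegrable_sub_mul hq hyc hg), coef_sub_mul hq hyc hg,
    ← coef_mul_synth hq (summable_coef_of_maps hm hq hg h),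
    coef_congr (f := fun x => q x * y x) fun x hx => by
      show q x * y x = q x * synth b (coef b y) x
      rw [← hE hx]]
  ring

/-- The series is not differentiated. Instead, the problem without potential is solved with
right-hand side `synth v - q * synth u`; its solution has the coefficients `u`, so by completeness
it is `synth u`, which thereby inherits the regularity and the boundary conditions. -/
theorem maps_synth (hm : 1 ≤ m) (hq : IntervalIntegrable q volume 0 π) {u v : ℕ → ℂ}
    (hu : Summable fun k => ‖u k‖) (hv : Summable fun k => ‖v k‖)
    (h : ∀ j, freeEigenvalue b m j * u j + ∑' k, potentialMatrix b q j k * u k = v j) :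
    Maps b m q (synth b u) (synth b v) := by
  have huc := (continuous_synth (b := b) hu).continuousOn (s := Icc 0 π)
  have hvc := (continuous_synth (b := b) hv).continuousOn (s := Icc 0 π)
  have hi := intervalIntegrable_sub_mul hq huc hvc
  obtain ⟨y, hy⟩ := exists_maps_zero_potential b hm hi
  have hE : EqOn y (synth b u) (Icc 0 π) := by
    refine eqOn_of_coef_eq (b := b) hy.contDiffOn.continuousOn huc fun k => ?_
    have h1 := coef_of_maps hm hy (by simpa using hi) k
    simp only [Pi.zero_apply, zero_mul, sub_zero] at h1
    rw [coef_sub_mul hq huc hvc, coef_mul_synth hq hu, coef_synth hv, ← h k,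
      add_sub_cancel_right] at h1
    rw [coef_synth hu]
    exact mul_left_cancel₀ (by exact_mod_cast (freeEigenvalue_pos b m k).ne') h1
  have h2 := hy.congr hE (Set.eqOn_refl _ _)
  refine ⟨h2.contDiffOn, h2.absCont, h2.boundary, ?_⟩
  filter_upwards [h2.equation] with x ⟨e, he, hx⟩
  refine ⟨e, he, ?_⟩
  simp only [Pi.zero_apply, zero_mul, add_zero] at hx
  rw [hx]
  ring

end Correspondence

/-! ### Root spaces and algebraic multiplicity through a finite-dimensional model -/

section RootSpaces

variable {b : Boundary} {m : ℕ} {hm : 1 ≤ m} {q : ℝ → ℂ}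

/-- Induction on `k`: `hpre` puts every element of the next preimage into the range of `E`, and
`huniq` identifies the image there with `B v`, so the recursion for root spaces becomes the one for
`ker (B - z) ^ k`. -/
theorem rootSpace_eq_map {V : Type*} [AddCommGroup V] [Module ℂ V] {B : Module.End ℂ V}
    {E : V →ₗ[ℂ] (ℝ → ℂ)} (hsupp : ∀ v x, x ∉ Icc 0 π → E v x = 0)
    (hmaps : ∀ v, Maps b m q (E v) (E (B v)))
    (huniq : ∀ v g, Maps b m q (E v) (E g) → g = B v) {z : ℂ}
    (hpre : ∀ y a, (∀ x, x ∉ Icc 0 π → y x = 0) → Maps b m q y (z • y + E a) → ∃ v, y = E v)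
    (k : ℕ) : rootSpace b m hm q z k = (B.genEigenspace z k).map E := by
  induction k with
  | zero =>
    rw [Module.End.genEigenspace_nat, pow_zero]
    have : LinearMap.ker (1 : Module.End ℂ V) = ⊥ := LinearMap.ker_id
    rw [this, Submodule.map_bot]
    rfl
  | succ k ih =>
    have hker : ∀ v, v ∈ B.genEigenspace z (k + 1 : ℕ) ↔ B v - z • v ∈ B.genEigenspace z k := by
      intro v
      rw [Module.End.genEigenspace_nat, Module.End.genEigenspace_nat, LinearMap.mem_ker,
        LinearMap.mem_ker, pow_succ, Module.End.mul_apply]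
      rfl
    have hrel : ∀ v w, z • E v + E w = E (z • v + w) := fun v w => by simp
    ext y
    constructor
    · rintro ⟨hy, w, hw, h⟩
      rw [ih] at hw
      obtain ⟨a, ha, rfl⟩ := hw
      obtain ⟨v, rfl⟩ := hpre y a hy h
      refine ⟨v, (hker v).2 ?_, rfl⟩
      rw [hrel] at h
      rwa [← huniq v _ h, add_sub_cancel_left]
    · rintro ⟨v, hv, rfl⟩
      refine ⟨hsupp v, E (B v - z • v), ?_, ?_⟩
      · rw [ih]
        exact ⟨_, (hker v).1 hv, rfl⟩
      · rw [hrel, add_sub_cancel]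
        exact hmaps v

theorem algMult_eq_count_roots {V : Type} [AddCommGroup V] [Module ℂ V] [FiniteDimensional ℂ V]
    {B : Module.End ℂ V} {E : V →ₗ[ℂ] (ℝ → ℂ)} (hE : Function.Injective E) {z : ℂ}
    (h : ∀ k, rootSpace b m hm q z k = (B.genEigenspace z k).map E) :
    algMult b m hm q z = B.charpoly.roots.count z := by
  have e : (⨆ k : ℕ, rootSpace b m hm q z k) = (B.genEigenspace z ⊤).map E := by
    rw [Module.End.genEigenspace_top, Submodule.map_iSup]
    exact iSup_congr h
  unfold algMult
  rw [e, rank_map_eq hE, ← Module.finrank_eq_rank, map_natCast]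
  have := LinearMap.finrank_maxGenEigenspace_eq B z
  rw [Polynomial.count_roots, ← this]

/-- Some root space is nonzero, and the first such one consists of functions sent to zero by `L -
z`. -/
theorem exists_eigenfunction_of_algMult_ne_zero {z : ℂ} (h : algMult b m hm q z ≠ 0) :
    ∃ y, IsEigenfunction b m q z y := by
  have hk : ∀ k, rootSpace b m hm q z k ≠ ⊥ → ∃ y, IsEigenfunction b m q z y := by
    intro k
    induction k with
    | zero => exact fun h => absurd rfl h
    | succ k ih =>
      intro hne
      by_cases hb : rootSpace b m hm q z k = ⊥
      · obtain ⟨y, ⟨hy, w, hw, hmap⟩, hy0⟩ := Submodule.exists_mem_ne_zero_of_ne_bot hne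
        rw [hb, Submodule.mem_bot] at hw
        subst hw
        rw [add_zero] at hmap
        refine ⟨y, ?_, hmap⟩
        by_contra! hz
        refine hy0 (funext fun x => ?_)
        by_cases hx : x ∈ Icc 0 π
        · exact hz x hx
        · exact hy x hx
      · exact ih hb
  by_contra! hno
  refine h ?_
  have : (⨆ k : ℕ, rootSpace b m hm q z k) = ⊥ :=
    iSup_eq_bot.2 fun k => by
      by_contra hne
      obtain ⟨y, hy⟩ := hk k hne
      exact hno y hy
  unfold algMult
  rw [this, rank_bot]
  simp

end RootSpaces

/-! ### Eigenvalue count in a disc and shape of eigenfunctions in an annulus -/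

section Spectrum

variable {b : Boundary} {m : ℕ} {q : ℝ → ℂ} {A τ : ℝ} {n : ℕ}

theorem synth_add {u v : ℕ → ℂ} (hu : Summable fun k => ‖u k‖) (hv : Summable fun k => ‖v k‖) :
    synth b (u + v) = synth b u + synth b v := by
  funext x
  simp only [synth, Pi.add_apply]
  rw [← (summable_synth hu x).tsum_add (summable_synth hv x)]
  exact tsum_congr fun k => add_mul _ _ _

theorem synth_smul (c : ℂ) (u : ℕ → ℂ) : synth b (c • u) = c • synth b u := by
  funext x
  simp only [synth, Pi.smul_apply, smul_eq_mul, mul_assoc]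
  exact tsum_mul_left

/-- The composition of `synth` with a map to absolutely summable sequences, the functions being
extended by zero. -/
noncomputable def synthMap (b : Boundary) {V : Type*} [AddCommGroup V] [Module ℂ V]
    (E : V →ₗ[ℂ] (ℕ → ℂ)) (hE : ∀ v, Summable fun k => ‖E v k‖) : V →ₗ[ℂ] (ℝ → ℂ) where
  toFun v := indicator (Icc 0 π) (synth b (E v))
  map_add' v w := by rw [map_add, synth_add (hE v) (hE w)]; exact indicator_add' _ _ _
  map_smul' c v := by rw [map_smul, synth_smul]; exact indicator_const_smul (Icc 0 π) c (synth b (E v))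

/-- The multiset consists of the characteristic roots of `B`, of which there are `n + 1` over `ℂ`.
The graph is carried to functions by `synthMap`, where coefficients recover `E v`; this gives
injectivity and uniqueness of the image. -/
theorem exists_multiset_algMult (hm : 1 ≤ m) (hq : IntervalIntegrable q volume 0 π)
    (hA : ∀ j k, ‖potentialMatrix b q j k‖ ≤ A)
    (h1 : Summable fun k => |freeEigenvalue b m k - freeEigenvalue b m n|⁻¹)
    (h1τ : ∑' k, |freeEigenvalue b m k - freeEigenvalue b m n|⁻¹ ≤ τ)
    (h2 : Summable fun k => |freeEigenvalue b m k - freeEigenvalue b m (n + 1)|⁻¹)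
    (h2τ : ∑' k, |freeEigenvalue b m k - freeEigenvalue b m (n + 1)|⁻¹ ≤ τ)
    (hAτ : A * τ ≤ 1 / 8) :
    ∃ S : Multiset ℂ, S.card = n + 1 ∧
      (∀ z ∈ S, ‖z‖ < (freeEigenvalue b m n + freeEigenvalue b m (n + 1)) / 2) ∧
      ∀ z, ‖z‖ < (freeEigenvalue b m n + freeEigenvalue b m (n + 1)) / 2 →
        algMult b m hm q z = S.count z := by
  obtain ⟨E, B, hEinj, hEs, hinv, hpre, heig⟩ := exists_invariant_subspace
    (strictMono_freeEigenvalue b hm) (fun k => (freeEigenvalue_pos b m k).le) hA h1 h1τ h2 h2τ hAτ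
  set G := synthMap b E hEs with hG
  have hGE : ∀ v, EqOn (synth b (E v)) (G v) (Icc 0 π) := fun v x hx =>
    (indicator_of_mem hx (synth b (E v))).symm
  have hGc : ∀ v, ContinuousOn (G v) (Icc 0 π) := fun v =>
    (continuous_synth (hEs v)).continuousOn.congr (hGE v).symm
  have hGcoef : ∀ v k, coef b (G v) k = E v k := fun v k => by
    rw [← coef_congr (hGE v), coef_synth (hEs v)]
  have hGsupp : ∀ v x, x ∉ Icc 0 π → G v x = 0 := fun v x hx => indicator_of_notMem hx _
  have hGinj : Function.Injective G := fun v w h => hEinj (funext fun k => by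
    rw [← hGcoef, ← hGcoef, h])
  have hGmaps : ∀ v, Maps b m q (G v) (G (B v)) := fun v =>
    (maps_synth hm hq (hEs v) (hEs (B v)) (hinv v)).congr (hGE v) (hGE (B v))
  have hGuniq : ∀ v g, Maps b m q (G v) (G g) → g = B v := by
    intro v g h
    refine hEinj (funext fun j => ?_)
    have e1 := coef_equation_of_maps hm hq (hGc g) h j
    have e2 := coef_equation_of_maps hm hq (hGc (B v)) (hGmaps v) j
    rw [← hGcoef, ← hGcoef]
    exact e1.symm.trans e2
  refine ⟨B.charpoly.roots, ?_, fun z hz => ?_, fun z hz => ?_⟩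
  · rw [← (IsAlgClosed.splits B.charpoly).natDegree_eq_card_roots, LinearMap.charpoly_natDegree]
    simp
  · by_contra! hle
    have hev : B.HasEigenvalue z := by
      rw [Module.End.hasEigenvalue_iff_isRoot_charpoly]
      exact Polynomial.isRoot_of_mem_roots hz
    obtain ⟨v, hv⟩ := hev.exists_hasEigenvector
    exact hv.2 (heig z v hle hv.apply_eq_smul)
  · refine algMult_eq_count_roots hGinj fun k =>
      rootSpace_eq_map hGsupp hGmaps hGuniq (fun y a hy h => ?_) k
    have hg : ContinuousOn (z • y + G a) (Icc 0 π) :=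
      (h.contDiffOn.continuousOn.const_smul z).add (hGc a)
    have hs := summable_coef_of_maps hm hq hg h
    obtain ⟨v, hv⟩ := hpre (coef b y) z a hs hz.le fun j => by
      rw [coef_equation_of_maps hm hq hg h]
      have hyc : ContinuousOn y (uIcc 0 π) := uIcc_zero_pi ▸ h.contDiffOn.continuousOn
      have hac : ContinuousOn (G a) (uIcc 0 π) := uIcc_zero_pi ▸ hGc a
      have hs := (continuous_mode_complex b j).continuousOn (s := uIcc 0 π)
      rw [← hGcoef]
      unfold coef
      have i1 : IntervalIntegrable (fun x => y x * (mode b j x : ℂ)) volume 0 π :=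
        (hyc.mul hs).intervalIntegrable
      have i2 : IntervalIntegrable (fun x => G a x * (mode b j x : ℂ)) volume 0 π :=
        (hac.mul hs).intervalIntegrable
      rw [← intervalIntegral.integral_const_mul, ← intervalIntegral.integral_add
        (i1.const_mul z) i2]
      refine intervalIntegral.integral_congr fun x _ => ?_
      simp only [Pi.add_apply, Pi.smul_apply, smul_eq_mul]
      ring
    refine ⟨v, funext fun x => ?_⟩
    by_cases hx : x ∈ Icc 0 π
    · rw [eqOn_synth_of_maps hm hq hg h hx, hv, hGE v hx]
    · rw [hy x hx, hGsupp v x hx]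

/-- An eigenfunction for an eigenvalue in the annulus around `freeEigenvalue b m (n + 1)` is close
to a multiple of the corresponding mode. -/
theorem IsEigenfunction.approx (hm : 1 ≤ m) (hq : IntervalIntegrable q volume 0 π)
    (hA : ∀ j k, ‖potentialMatrix b q j k‖ ≤ A)
    (h1 : Summable fun k => |freeEigenvalue b m k - freeEigenvalue b m (n + 1)|⁻¹)
    (h1τ : ∑' k, |freeEigenvalue b m k - freeEigenvalue b m (n + 1)|⁻¹ ≤ τ)
    (hAτ : A * τ ≤ 1 / 8) {z : ℂ} {y : ℝ → ℂ} (hy : IsEigenfunction b m q z y)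
    (hz1 : (freeEigenvalue b m n + freeEigenvalue b m (n + 1)) / 2 ≤ ‖z‖)
    (hz2 : ‖z‖ ≤ (freeEigenvalue b m (n + 1) + freeEigenvalue b m (n + 2)) / 2) :
    (∃ a : ℂ, a ≠ 0 ∧ ∀ x ∈ Icc 0 π, ‖y x - a * mode b (n + 1) x‖ ≤ 4 * A * τ * ‖a‖) ∧
      (freeEigenvalue b m n + freeEigenvalue b m (n + 1)) / 2 ≤ z.re := by
  obtain ⟨⟨x₀, hx₀, hne⟩, hmap⟩ := hy
  have hyc := hmap.contDiffOn.continuousOn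
  have hg : ContinuousOn (fun x => z * y x) (Icc 0 π) := continuousOn_const.mul hyc
  set u := coef b y with hu
  have hs : Summable fun k => ‖u k‖ := summable_coef_of_maps hm hq hg hmap
  have hsyn := eqOn_synth_of_maps hm hq hg hmap
  obtain ⟨hc, hre⟩ := concentration (strictMono_freeEigenvalue b hm)
    (fun k => (freeEigenvalue_pos b m k).le) hA h1 h1τ hAτ hs hz1 hz2 fun j => by
      rw [coef_equation_of_maps hm hq hg hmap, hu]
      unfold coef
      simp_rw [mul_assoc]
      exact intervalIntegral.integral_const_mul _ _
  set a := u (n + 1) with ha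
  set r : ℕ → ℂ := fun k => u k - if k = n + 1 then a else 0 with hr
  have hrs : Summable fun k => ‖r k‖ := by
    refine Summable.of_nonneg_of_le (fun _ => norm_nonneg _) (fun k => norm_sub_le _ _)
      (hs.add (g := fun k => ‖if k = n + 1 then a else 0‖) ?_)
    exact summable_of_ne_finset_zero (s := {n + 1}) fun k hk => by
      rw [if_neg (by simpa using hk), norm_zero]
  have hdiff : ∀ x ∈ Icc 0 π, y x - a * mode b (n + 1) x = synth b r x := by
    intro x hx
    have h3 : HasSum (fun k => (if k = n + 1 then a else 0) * (mode b k x : ℂ))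
        (a * mode b (n + 1) x) := by
      have e : (fun k => (if k = n + 1 then a else 0) * (mode b k x : ℂ))
          = fun k => if k = n + 1 then a * (mode b (n + 1) x : ℂ) else 0 := funext fun k => by
        split_ifs with hk
        · rw [hk]
        · rw [zero_mul]
      rw [e]
      exact hasSum_ite_eq _ _
    rw [hsyn hx, synth, synth, ← h3.tsum_eq, ← (summable_synth hs x).tsum_sub h3.summable]
    exact tsum_congr fun k => (sub_mul _ _ _).symm
  have hle : ∀ x ∈ Icc 0 π, ‖y x - a * mode b (n + 1) x‖ ≤ 4 * A * τ * ‖a‖ := by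
    intro x hx
    rw [hdiff x hx]
    have h4 : √(2 / π) ≤ 1 := Real.sqrt_le_one.2 ((div_le_one Real.pi_pos).2 Real.two_le_pi)
    calc _ ≤ √(2 / π) * ∑' k, ‖r k‖ := norm_synth_le hrs x
      _ ≤ 1 * ∑' k, ‖r k‖ := by
        gcongr
      _ ≤ _ := by rw [one_mul]; exact hc
  -- With `a = 0` the estimate would make `y` vanish on all of `[0, π]`.
  have ha0 : a ≠ 0 := by
    intro h0
    have := hle x₀ hx₀
    rw [h0] at this
    simp only [zero_mul, sub_zero, norm_zero, mul_zero] at this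
    exact hne (norm_le_zero_iff.1 this)
  exact ⟨⟨a, ha0, hle⟩, hre ha0⟩

end Spectrum

/-! ### From approximation up to a scalar to normalized eigenfunctions -/

section Normalization

variable {b : Boundary} {k : ℕ} {y : ℝ → ℂ} {a : ℂ} {δ : ℝ}

theorem abs_mode_le_one (b : Boundary) (k : ℕ) (x : ℝ) : ‖(mode b k x : ℂ)‖ ≤ 1 :=
  (norm_mode_le b k x).trans (Real.sqrt_le_one.2 ((div_le_one Real.pi_pos).2 Real.two_le_pi))

theorem norm_integral_sub_le {f g : ℝ → ℂ} {c : ℝ} (hf : ContinuousOn f (Icc 0 π))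
    (hg : ContinuousOn g (Icc 0 π)) (h : ∀ x ∈ Icc 0 π, ‖f x - g x‖ ≤ c) :
    ‖(∫ x in (0 : ℝ)..π, f x) - ∫ x in (0 : ℝ)..π, g x‖ ≤ c * π := by
  rw [← uIcc_zero_pi] at hf hg
  rw [← intervalIntegral.integral_sub hf.intervalIntegrable hg.intervalIntegrable]
  have := intervalIntegral.norm_integral_le_of_norm_le_const (a := 0) (b := π) (C := c)
    (f := fun x => f x - g x) fun x hx => h x (by
      rw [uIoc_of_le Real.pi_pos.le] at hx
      exact Ioc_subset_Icc_self hx)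
  simpa [abs_of_pos Real.pi_pos] using this

theorem integral_sq_mode (a : ℂ) : ∫ x in (0 : ℝ)..π, (a * mode b k x) ^ 2 = a ^ 2 := by
  have h := coef_mode b k k
  rw [if_pos rfl] at h
  unfold coef at h
  have e : ∀ x, (a * mode b k x) ^ 2 = a ^ 2 * ((mode b k x : ℂ) * mode b k x) := fun x => by ring
  simp_rw [e]
  rw [intervalIntegral.integral_const_mul, h, mul_one]

theorem norm_integral_sq_sub_le (hyc : ContinuousOn y (Icc 0 π)) (hδ0 : 0 ≤ δ) (hδ : δ ≤ 1)
    (h : ∀ x ∈ Icc 0 π, ‖y x - a * mode b k x‖ ≤ δ * ‖a‖) :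
    ‖(∫ x in (0 : ℝ)..π, y x ^ 2) - a ^ 2‖ ≤ 3 * π * δ * ‖a‖ ^ 2 := by
  rw [← integral_sq_mode (b := b) (k := k) a]
  refine (norm_integral_sub_le (c := 3 * δ * ‖a‖ ^ 2) (hyc.pow 2)
    ((continuous_const.mul (continuous_mode_complex b k)).pow 2).continuousOn fun x hx => ?_).trans
    (le_of_eq (by ring))
  have h1 := h x hx
  have h2 := abs_mode_le_one b k x
  have e : y x ^ 2 - (a * mode b k x) ^ 2
      = (y x - a * mode b k x) * (2 * (a * mode b k x) + (y x - a * mode b k x)) := by ring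
  change ‖y x ^ 2 - (a * mode b k x) ^ 2‖ ≤ _
  rw [e, norm_mul]
  calc _ ≤ δ * ‖a‖ * (2 * (‖a‖ * 1) + δ * ‖a‖) := by
        refine mul_le_mul h1 ((norm_add_le _ _).trans (add_le_add ?_ h1)) (norm_nonneg _)
          (by positivity)
        rw [norm_mul, norm_mul, Complex.norm_ofNat]
        gcongr
    _ = (2 + δ) * (δ * ‖a‖ ^ 2) := by ring
    _ ≤ 3 * (δ * ‖a‖ ^ 2) := by gcongr; linarith
    _ = _ := by ring

theorem abs_integral_norm_sq_sub_le (hyc : ContinuousOn y (Icc 0 π)) (hδ0 : 0 ≤ δ) (hδ : δ ≤ 1)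
    (h : ∀ x ∈ Icc 0 π, ‖y x - a * mode b k x‖ ≤ δ * ‖a‖) :
    |(∫ x in (0 : ℝ)..π, ‖y x‖ ^ 2) - ‖a‖ ^ 2| ≤ 3 * π * δ * ‖a‖ ^ 2 := by
  -- With `y` and `a` replaced by their moduli, `integral_sq_mode` also serves the Hermitian
  -- normalization.
  set ya : ℝ → ℂ := fun x => (‖y x‖ : ℂ) with hya
  set aa : ℂ := (‖a‖ : ℂ) with haa
  have hsq : ((∫ x in (0 : ℝ)..π, ‖y x‖ ^ 2 : ℝ) : ℂ) = ∫ x in (0 : ℝ)..π, ya x ^ 2 := by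
    rw [← intervalIntegral.integral_ofReal]
    exact intervalIntegral.integral_congr fun x _ => by simp [hya]
  have e : |(∫ x in (0 : ℝ)..π, ‖y x‖ ^ 2) - ‖a‖ ^ 2|
      = ‖(∫ x in (0 : ℝ)..π, ya x ^ 2) - aa ^ 2‖ := by
    rw [← hsq, haa, ← Complex.ofReal_pow, ← Complex.ofReal_sub, Complex.norm_real,
      Real.norm_eq_abs]
  rw [e, ← integral_sq_mode (b := b) (k := k) aa]
  refine (norm_integral_sub_le (c := 3 * δ * ‖a‖ ^ 2)
    ((Complex.continuous_ofReal.comp_continuousOn hyc.norm).pow 2)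
    ((continuous_const.mul (continuous_mode_complex b k)).pow 2).continuousOn fun x hx => ?_).trans
    (le_of_eq (by ring))
  have h1 := h x hx
  have h2 := abs_mode_le_one b k x
  set p := ‖a * mode b k x‖ with hp
  have hpa : p ≤ ‖a‖ := by
    rw [hp, norm_mul]
    exact mul_le_of_le_one_right (norm_nonneg _) h2
  have hp0 : 0 ≤ p := norm_nonneg _
  have h3 : |‖y x‖ - p| ≤ δ * ‖a‖ := (abs_norm_sub_norm_le _ _).trans h1
  have h4 : ‖ya x ^ 2 - (aa * mode b k x) ^ 2‖ = |‖y x‖ ^ 2 - p ^ 2| := by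
    have : p ^ 2 = (‖a‖ * mode b k x) ^ 2 := by
      rw [hp, norm_mul, mul_pow, mul_pow, Complex.norm_real, Real.norm_eq_abs, sq_abs]
    rw [this, hya, haa, ← Real.norm_eq_abs, ← Complex.norm_real]
    push_cast
    rfl
  change ‖ya x ^ 2 - (aa * mode b k x) ^ 2‖ ≤ _
  rw [h4, show ‖y x‖ ^ 2 - p ^ 2 = (‖y x‖ - p) * (2 * p + (‖y x‖ - p)) by ring, abs_mul]
  calc _ ≤ δ * ‖a‖ * (2 * ‖a‖ + δ * ‖a‖) := by
        refine mul_le_mul h3 ((abs_add_le _ _).trans (add_le_add ?_ h3)) (abs_nonneg _)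
          (by positivity)
        rw [abs_of_nonneg (by positivity)]
        gcongr
    _ = (2 + δ) * (δ * ‖a‖ ^ 2) := by ring
    _ ≤ 3 * (δ * ‖a‖ ^ 2) := by gcongr; linarith
    _ = _ := by ring

theorem norm_mul_sub_mode_le (hδ0 : 0 ≤ δ) (h : ∀ x ∈ Icc 0 π, ‖y x - a * mode b k x‖ ≤ δ * ‖a‖)
    (ha2 : ‖a‖ ≤ 2) {σ : ℂ} (hσ : ‖σ‖ = 1) (hσa : ‖σ * a - 1‖ ≤ 6 * π * δ) {x : ℝ}
    (hx : x ∈ Icc 0 π) : ‖σ * y x - (mode b k x : ℂ)‖ ≤ 27 * δ := by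
  have e : σ * y x - (mode b k x : ℂ)
      = (σ * a - 1) * mode b k x + σ * (y x - a * mode b k x) := by ring
  rw [e]
  refine (norm_add_le _ _).trans ?_
  rw [norm_mul, norm_mul, hσ, one_mul]
  have h1 := abs_mode_le_one b k x
  calc _ ≤ 6 * π * δ * 1 + δ * 2 := by
        refine add_le_add (mul_le_mul hσa h1 (norm_nonneg _) (by positivity)) ((h x hx).trans ?_)
        gcongr
    _ ≤ _ := by nlinarith [Real.pi_lt_four]

/-- The normalization gives `a² = 1 + O(δ)`. The sign is chosen so that `c = σ a` has nonnegative
real part; then `‖c + 1‖ ≥ 1`, and `‖c - 1‖ ≤ ‖c² - 1‖`. -/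
theorem exists_sign (hyc : ContinuousOn y (Icc 0 π)) (hδ0 : 0 ≤ δ) (hδ : 6 * π * δ ≤ 1)
    (h : ∀ x ∈ Icc 0 π, ‖y x - a * mode b k x‖ ≤ δ * ‖a‖)
    (hn : ∫ x in (0 : ℝ)..π, y x ^ 2 = 1) :
    ∃ σ : ℂ, (σ = 1 ∨ σ = -1) ∧ ∀ x ∈ Icc 0 π, ‖σ * y x - (mode b k x : ℂ)‖ ≤ 27 * δ := by
  have hδ1 : δ ≤ 1 := by nlinarith [Real.pi_gt_three]
  have h1 := norm_integral_sq_sub_le hyc hδ0 hδ1 h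
  rw [hn] at h1
  have h2 : ‖a‖ ^ 2 ≤ 2 := by
    have h3 : ‖a‖ ^ 2 ≤ 1 + ‖1 - a ^ 2‖ := by
      have := norm_sub_norm_le (a ^ 2) 1
      rw [norm_pow, norm_one, norm_sub_rev] at this
      linarith
    nlinarith [sq_nonneg ‖a‖]
  have h3 : ‖a ^ 2 - 1‖ ≤ 6 * π * δ := by
    rw [norm_sub_rev]
    refine h1.trans ?_
    have : 0 ≤ 3 * π * δ := by positivity
    nlinarith
  have key : ∀ c : ℂ, c ^ 2 = a ^ 2 → 0 ≤ c.re → ‖c - 1‖ ≤ 6 * π * δ := by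
    intro c hc hre
    have h4 : 1 ≤ ‖c + 1‖ := by
      refine le_trans ?_ (Complex.re_le_norm _)
      simp only [Complex.add_re, Complex.one_re]
      linarith
    have h5 : ‖c - 1‖ * ‖c + 1‖ ≤ 6 * π * δ := by
      rw [← norm_mul, show (c - 1) * (c + 1) = a ^ 2 - 1 by rw [← hc]; ring]
      exact h3
    nlinarith [norm_nonneg (c - 1)]
  have ha2 : ‖a‖ ≤ 2 := by nlinarith [norm_nonneg a]
  rcases le_total 0 a.re with hre | hre
  · exact ⟨1, Or.inl rfl, fun x hx => norm_mul_sub_mode_le hδ0 h ha2 (by simp)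
      (key _ (by ring) (by simpa using hre)) hx⟩
  · exact ⟨-1, Or.inr rfl, fun x hx => norm_mul_sub_mode_le hδ0 h ha2 (by simp)
      (key _ (by ring) (by simpa using hre)) hx⟩

theorem exists_phase (hyc : ContinuousOn y (Icc 0 π)) (ha : a ≠ 0) (hδ0 : 0 ≤ δ)
    (hδ : 6 * π * δ ≤ 1) (h : ∀ x ∈ Icc 0 π, ‖y x - a * mode b k x‖ ≤ δ * ‖a‖)
    (hn : ∫ x in (0 : ℝ)..π, ‖y x‖ ^ 2 = 1) :
    ∃ σ : ℂ, ‖σ‖ = 1 ∧ ∀ x ∈ Icc 0 π, ‖σ * y x - (mode b k x : ℂ)‖ ≤ 27 * δ := by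
  have hδ1 : δ ≤ 1 := by nlinarith [Real.pi_gt_three]
  have h1 := abs_integral_norm_sq_sub_le hyc hδ0 hδ1 h
  rw [hn] at h1
  have h0 : 0 ≤ 3 * π * δ := by positivity
  have h2 : ‖a‖ ^ 2 ≤ 2 := by
    have := (abs_le.1 h1).1
    nlinarith [sq_nonneg ‖a‖]
  have h3 : |‖a‖ ^ 2 - 1| ≤ 6 * π * δ := by
    rw [abs_sub_comm]
    refine h1.trans ?_
    nlinarith
  have hpos : 0 < ‖a‖ := norm_pos_iff.2 ha
  have hσ : ‖(starRingEnd ℂ) a / ‖a‖‖ = 1 := by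
    rw [norm_div, Complex.norm_conj, Complex.norm_real, norm_norm, div_self hpos.ne']
  refine ⟨(starRingEnd ℂ) a / ‖a‖, hσ, fun x hx =>
    norm_mul_sub_mode_le hδ0 h (by nlinarith) hσ ?_ hx⟩
  have e : (starRingEnd ℂ) a / ‖a‖ * a - 1 = ((‖a‖ - 1 : ℝ) : ℂ) := by
    have h5 : (‖a‖ : ℂ) ≠ 0 := by exact_mod_cast hpos.ne'
    rw [div_mul_eq_mul_div, mul_comm, Complex.mul_conj, Complex.normSq_eq_norm_sq]
    push_cast
    rw [pow_two, mul_div_assoc, div_self h5, mul_one]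
  rw [e, Complex.norm_real, Real.norm_eq_abs]
  refine le_trans ?_ h3
  rw [show ‖a‖ ^ 2 - 1 = (‖a‖ - 1) * (‖a‖ + 1) by ring, abs_mul]
  refine le_mul_of_one_le_right (abs_nonneg _) ?_
  rw [abs_of_pos (by positivity)]
  linarith

theorem IsEigenfunction.smul {m : ℕ} {q : ℝ → ℂ} {z c : ℂ} (hc : c ≠ 0)
    (hy : IsEigenfunction b m q z y) : IsEigenfunction b m q z (c • y) := by
  obtain ⟨⟨x, hx, hne⟩, h⟩ := hy
  refine ⟨⟨x, hx, mul_ne_zero hc hne⟩, (h.smul c).congr (fun _ _ => rfl) fun x _ => ?_⟩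
  simp only [Pi.smul_apply, smul_eq_mul]
  ring

/-- For complex-valued `y` the integral of `y²` could vanish. Here it is within `‖a‖² / 2` of `a²`,
hence nonzero, and a complex square root rescales it to `1`. -/
theorem exists_normalized {m : ℕ} {q : ℝ → ℂ} {z : ℂ} (hy : IsEigenfunction b m q z y)
    (ha : a ≠ 0) (hδ0 : 0 ≤ δ) (hδ : 6 * π * δ ≤ 1)
    (h : ∀ x ∈ Icc 0 π, ‖y x - a * mode b k x‖ ≤ δ * ‖a‖) :
    ∃ w : ℝ → ℂ, IsEigenfunction b m q z w ∧ ∫ x in (0 : ℝ)..π, w x ^ 2 = 1 := by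
  have hδ1 : δ ≤ 1 := by nlinarith [Real.pi_gt_three]
  have h1 := norm_integral_sq_sub_le hy.2.contDiffOn.continuousOn hδ0 hδ1 h
  have hpos : 0 < ‖a‖ ^ 2 := by positivity
  have hI : ∫ x in (0 : ℝ)..π, y x ^ 2 ≠ 0 := by
    intro h0
    rw [h0, zero_sub, norm_neg, norm_pow] at h1
    nlinarith
  obtain ⟨c, hc⟩ := IsAlgClosed.exists_pow_nat_eq (∫ x in (0 : ℝ)..π, y x ^ 2)⁻¹ two_pos
  have hc0 : c ≠ 0 := by
    rintro rfl
    exact inv_ne_zero hI (by rw [← hc]; ring)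
  refine ⟨c • y, hy.smul hc0, ?_⟩
  simp only [Pi.smul_apply, smul_eq_mul, mul_pow]
  rw [intervalIntegral.integral_const_mul, hc, inv_mul_cancel₀ hI]

end Normalization

/-! ### From the square norm of the potential to its integral norm -/

section Potential

theorem intervalIntegrable_of_memLp {q : ℝ → ℂ}
    (hq : MemLp q 2 (volume.restrict (Ioo (0 : ℝ) π))) : IntervalIntegrable q volume 0 π := by
  have h := hq.integrable one_le_two
  rw [restrict_Ioo_eq_restrict_Ioc] at h
  exact (intervalIntegrable_iff_integrableOn_Ioc_of_le Real.pi_pos.le).2 h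

theorem integral_norm_le_of_eLpNorm_lt {q : ℝ → ℂ} {M : ℝ}
    (hq : MemLp q 2 (volume.restrict (Ioo (0 : ℝ) π)))
    (hM : eLpNorm q 2 (volume.restrict (Ioo (0 : ℝ) π)) < ENNReal.ofReal M) :
    ∫ x in (0 : ℝ)..π, ‖q x‖ ≤ M * √π := by
  have hM0 : 0 < M := ENNReal.ofReal_pos.1 (hM.bot_lt)
  have h1 := eLpNorm_le_eLpNorm_mul_rpow_measure_univ one_le_two hq.aestronglyMeasurable
  rw [intervalIntegral.integral_of_le Real.pi_pos.le, ← restrict_Ioo_eq_restrict_Ioc,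
    integral_norm_eq_lintegral_enorm hq.aestronglyMeasurable, ← eLpNorm_one_eq_lintegral_enorm]
  refine ENNReal.toReal_le_of_le_ofReal (by positivity) (h1.trans ?_)
  rw [ENNReal.ofReal_mul hM0.le]
  refine mul_le_mul' hM.le (le_of_eq ?_)
  rw [Measure.restrict_apply_univ, Real.volume_Ioo, sub_zero, Real.sqrt_eq_rpow,
    ENNReal.ofReal_rpow_of_pos Real.pi_pos]
  norm_num

end Potential

/-! ### Midpoint radii, location of the spectrum and the shift of indices -/

section Main

/-- A point midway between two consecutive unperturbed eigenvalues. -/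
noncomputable def gapRadius (b : Boundary) (m N : ℕ) : ℝ :=
  (freeEigenvalue b m (N - 1) + freeEigenvalue b m N) / 2

/-- At `N = 0` truncated subtraction makes the radius `d 0`, so monotonicity holds from the start.
-/
theorem monotone_gapRadius (b : Boundary) {m : ℕ} (hm : 1 ≤ m) : Monotone (gapRadius b m) := by
  intro i j hij
  have h := (strictMono_freeEigenvalue b hm).monotone
  have h1 := h hij
  have h2 := h (show i - 1 ≤ j - 1 by omega)
  unfold gapRadius
  linarith

theorem tendsto_gapRadius (b : Boundary) {m : ℕ} (hm : 1 ≤ m) :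
    Filter.Tendsto (gapRadius b m) Filter.atTop Filter.atTop := by
  refine Filter.tendsto_atTop_mono (fun N => ?_)
    ((tendsto_freeEigenvalue b hm).atTop_div_const two_pos)
  have := freeEigenvalue_pos b m (N - 1)
  unfold gapRadius
  linarith

/-- The bound of `gap_sum_le`. -/
noncomputable def gapBound (m n : ℕ) : ℝ :=
  6 * 2 ^ (2 * m - 1) * (Real.log (n + 1 : ℕ) / ((n + 1 : ℕ) : ℝ) ^ (2 * m - 1))

theorem tendsto_gapBound {m : ℕ} (hm : 1 ≤ m) :
    Filter.Tendsto (gapBound m) Filter.atTop (nhds 0) := by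
  have h := (((tendsto_log_div_pow (show 1 ≤ 2 * m - 1 by omega)).comp
    (Filter.tendsto_add_atTop_nat 1)).const_mul (6 * 2 ^ (2 * m - 1)))
  rw [mul_zero] at h
  exact h

variable {b : Boundary} {m : ℕ} {q : ℝ → ℂ} {A : ℝ} {N₀ : ℕ}

/-- An eigenvalue outside the disc lies in some annulus further out. There `IsEigenfunction.approx`
bounds its real part below by the inner radius, which is at least `gapRadius b m N`. -/
theorem gapRadius_le_re (hm : 1 ≤ m) (hq : IntervalIntegrable q volume 0 π)
    (hA : ∀ j k, ‖potentialMatrix b q j k‖ ≤ A) (hN₀ : 1 ≤ N₀)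
    (hτ : ∀ n ≥ N₀, A * gapBound m n ≤ 1 / 8) {N : ℕ} (hN : N₀ ≤ N) {z : ℂ}
    (hz : algMult b m hm q z ≠ 0) (hNz : gapRadius b m N ≤ ‖z‖) : gapRadius b m N ≤ z.re := by
  obtain ⟨y, hy⟩ := exists_eigenfunction_of_algMult_ne_zero hz
  have hex : ∃ K, ‖z‖ < gapRadius b m K :=
    ((tendsto_gapRadius b hm).eventually_gt_atTop ‖z‖).exists
  classical
  have h1 := Nat.find_spec hex
  have h2 : gapRadius b m (Nat.find hex - 1) ≤ ‖z‖ := by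
    rcases Nat.eq_zero_or_pos (Nat.find hex) with h0 | hpos
    · rw [h0] at h1
      exact absurd (h1.trans_le ((monotone_gapRadius b hm N.zero_le).trans hNz)) (lt_irrefl _)
    · exact not_lt.1 (Nat.find_min hex (show Nat.find hex - 1 < Nat.find hex by omega))
  set K := Nat.find hex
  have hNK : N < K := by
    by_contra! h
    exact absurd (h1.trans_le ((monotone_gapRadius b hm h).trans hNz)) (lt_irrefl _)
  obtain ⟨n, hn⟩ : ∃ n, K = n + 2 := ⟨K - 2, by omega⟩
  rw [hn] at h1 h2 hNK
  obtain ⟨hs, hsτ⟩ := gap_sum_le b hm (show 1 ≤ n + 1 by omega)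
  exact (monotone_gapRadius b hm (Nat.le_of_lt_succ hNK)).trans
    (hy.approx hm hq hA hs hsτ (hτ (n + 1) (by omega)) h2 h1.le).2

theorem exists_multisets (hm : 1 ≤ m) (hq : IntervalIntegrable q volume 0 π) (hA0 : 0 < A)
    (hA : ∀ j k, ‖potentialMatrix b q j k‖ ≤ A) {N₁ : ℕ} (hN₁ : 1 ≤ N₁)
    (hτ : ∀ n ≥ N₁, A * gapBound m n ≤ 1 / 8) :
    ∃ S : ℕ → Multiset ℂ, (∀ N ≥ N₁ + 1, (S N).card = N) ∧
      (∀ N ≥ N₁ + 1, ∀ z ∈ S N, ‖z‖ < gapRadius b m N) ∧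
      ∀ N ≥ N₁ + 1, ∀ z, ‖z‖ < gapRadius b m N → algMult b m hm q z = (S N).count z := by
  have key : ∀ N ≥ N₁ + 1, ∃ S : Multiset ℂ, S.card = N ∧ (∀ z ∈ S, ‖z‖ < gapRadius b m N) ∧
      ∀ z, ‖z‖ < gapRadius b m N → algMult b m hm q z = S.count z := by
    intro N hN
    obtain ⟨n, rfl⟩ : ∃ n, N = n + 1 := ⟨N - 1, by omega⟩
    have hle : ∀ n ≥ N₁, gapBound m n ≤ 1 / 8 / A := fun n hn => by
      rw [le_div_iff₀ hA0, mul_comm]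
      exact hτ n hn
    obtain ⟨h1, h1τ⟩ := gap_sum_le b hm (show 1 ≤ n by omega)
    obtain ⟨h2, h2τ⟩ := gap_sum_le b hm (show 1 ≤ n + 1 by omega)
    exact exists_multiset_algMult hm hq hA h1 (h1τ.trans (hle n (by omega))) h2
      (h2τ.trans (hle (n + 1) (by omega))) (mul_div_cancel₀ _ hA0.ne').le
  choose! S h1 h2 h3 using key
  exact ⟨S, h1, h2, h3⟩

theorem isEigenvalueSequence_iff {hm : 1 ≤ m} {Λ : ℕ → ℂ} :
    IsEigenvalueSequence b m hm q Λ ↔ IsListing (algMult b m hm q) fun i => Λ (i + 1) := by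
  unfold IsEigenvalueSequence IsListing
  simp_rw [encard_succ_fiber]
  refine and_congr_right fun _ => ⟨fun h i j hij => h _ _ (by omega) (by omega), fun h i j hi hij => ?_⟩
  have := h (show i - 1 ≤ j - 1 by omega)
  simpa only [Nat.sub_add_cancel hi, Nat.sub_add_cancel (hi.trans hij)] using this

end Main

end HigherOrderSL

/-! ### Choice of constants and conclusion -/

open HigherOrderSL in
theorem theorem3p5 (m : ℕ) (hm : 1 ≤ m) (M : ℝ) (hM : 0 < M) :
    ∃ P₁ : ℕ, 0 < P₁ ∧ ∃ C : ℝ, 0 < C ∧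
      ∀ q : ℝ → ℂ, MemLp q 2 (volume.restrict (Ioo (0 : ℝ) π)) →
        eLpNorm q 2 (volume.restrict (Ioo (0 : ℝ) π)) < ENNReal.ofReal M →
        ∀ b : HigherOrderSL.Boundary,
          (∃ Λ : ℕ → ℂ, HigherOrderSL.IsEigenvalueSequence b m hm q Λ) ∧
          ∀ Λ : ℕ → ℂ, HigherOrderSL.IsEigenvalueSequence b m hm q Λ → ∀ n : ℕ, P₁ < n →
            (∃ y : ℝ → ℂ, HigherOrderSL.IsEigenfunction b m q (Λ n) y ∧
              (∫ x in (0 : ℝ)..π, y x ^ 2) = 1) ∧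
            ∀ y : ℝ → ℂ, HigherOrderSL.IsEigenfunction b m q (Λ n) y →
              ((∫ x in (0 : ℝ)..π, y x ^ 2) = 1 →
                ∃ σ : ℂ, (σ = 1 ∨ σ = -1) ∧ ∀ x ∈ Icc 0 π,
                  ‖σ * y x - ((√(2 / π) * Real.sin (b.freq n * x) : ℝ) : ℂ)‖
                    ≤ C * (Real.log n / (n : ℝ) ^ (2 * m - 1))) ∧
              ((∫ x in (0 : ℝ)..π, ‖y x‖ ^ 2) = 1 →
                ∃ σ : ℂ, ‖σ‖ = 1 ∧ ∀ x ∈ Icc 0 π,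
                  ‖σ * y x - ((√(2 / π) * Real.sin (b.freq n * x) : ℝ) : ℂ)‖
                    ≤ C * (Real.log n / (n : ℝ) ^ (2 * m - 1))) := by
  set A : ℝ := 2 / π * (M * √π) with hA_def
  have hA0 : 0 < A := by positivity
  -- The counting needs only `1/8`; the smaller bound `1/100` is for normalization, where `6 π δ =
  -- 24 π A gapBound ≤ 1` is required.
  obtain ⟨N₁, hN₁, hsmall⟩ : ∃ N₁, 1 ≤ N₁ ∧ ∀ n ≥ N₁, A * gapBound m n ≤ 1 / 100 := by
    have h := (tendsto_gapBound hm).const_mul A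
    rw [mul_zero] at h
    obtain ⟨K, hK⟩ := Filter.eventually_atTop.1
      (h.eventually_le_const (show (0 : ℝ) < 1 / 100 by norm_num))
    exact ⟨K + 1, by omega, fun n hn => hK n (by omega)⟩
  refine ⟨N₁ + 1, by omega, 27 * (4 * A * (6 * 2 ^ (2 * m - 1))), by positivity,
    fun q hq2 hqM b => ?_⟩
  have hq := intervalIntegrable_of_memLp hq2
  have hA : ∀ j k, ‖potentialMatrix b q j k‖ ≤ A := fun j k =>
    (norm_potentialMatrix_le hq j k).trans
      (mul_le_mul_of_nonneg_left (integral_norm_le_of_eLpNorm_lt hq2 hqM) (by positivity))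
  have hτ : ∀ n ≥ N₁, A * gapBound m n ≤ 1 / 8 := fun n hn => (hsmall n hn).trans (by norm_num)
  obtain ⟨S, hcard, hlt, hcount⟩ := exists_multisets (b := b) hm hq hA0 hA hN₁ hτ
  have hre : ∀ N ≥ N₁ + 1, ∀ z, algMult b m hm q z ≠ 0 → gapRadius b m N ≤ ‖z‖ →
      gapRadius b m N ≤ z.re := fun N hN z hz hNz =>
    gapRadius_le_re hm hq hA (show 1 ≤ N₁ + 1 by omega) (fun n hn => hτ n (by omega)) hN hz hNz
  constructor
  · obtain ⟨Λ, hΛ⟩ := exists_isListing (monotone_gapRadius b hm) (tendsto_gapRadius b hm)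
      hcard hlt hcount hre
    exact ⟨fun n => Λ (n - 1), isEigenvalueSequence_iff.2 hΛ⟩
  · intro Λ hΛ n hn
    -- Listings start at `1` and modes at `0`, so entry `j + 2` belongs to `mode b (j + 1)`, in the
    -- annulus between the radii `j + 1` and `j + 2`.
    obtain ⟨j, rfl⟩ : ∃ j, n = j + 2 := ⟨n - 2, by omega⟩
    obtain ⟨hμ, hz1, hz2⟩ := (isEigenvalueSequence_iff.1 hΛ).annulus hcard hlt hcount hre
      (i := j + 1) (by omega)
    obtain ⟨hs, hsτ⟩ := gap_sum_le b hm (show 1 ≤ j + 1 by omega)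
    set δ := 4 * A * gapBound m (j + 1) with hδ_def
    have hδ0 : 0 ≤ δ := by
      have : 0 ≤ gapBound m (j + 1) := (tsum_nonneg fun _ => by positivity).trans hsτ
      positivity
    have hδ : 6 * π * δ ≤ 1 := by
      have h1 := hsmall (j + 1) (by omega)
      have h2 : 6 * π * δ = 24 * π * (A * gapBound m (j + 1)) := by rw [hδ_def]; ring
      rw [h2]
      nlinarith [Real.pi_lt_d2, Real.pi_pos]
    have hC : 27 * δ = 27 * (4 * A * (6 * 2 ^ (2 * m - 1)))
        * (Real.log (j + 2 : ℕ) / ((j + 2 : ℕ) : ℝ) ^ (2 * m - 1)) := by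
      rw [hδ_def, gapBound]
      ring
    have happ : ∀ y, IsEigenfunction b m q (Λ (j + 2)) y →
        ∃ a : ℂ, a ≠ 0 ∧ ∀ x ∈ Icc 0 π, ‖y x - a * mode b (j + 1) x‖ ≤ δ * ‖a‖ := fun y hy =>
      (hy.approx hm hq hA hs hsτ (hτ (j + 1) (by omega)) hz1 hz2.le).1
    refine ⟨?_, fun y hy => ?_⟩
    · obtain ⟨y, hy⟩ := exists_eigenfunction_of_algMult_ne_zero hμ
      obtain ⟨a, ha, h⟩ := happ y hy
      exact exists_normalized hy ha hδ0 hδ h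
    · obtain ⟨a, ha, h⟩ := happ y hy
      have hyc := hy.2.contDiffOn.continuousOn
      rw [← hC]
      exact ⟨fun hn => exists_sign hyc hδ0 hδ h hn, fun hn => exists_phase hyc ha hδ0 hδ h hn⟩
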